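/- All graphs are finite and simple. Let $H$ be a connected graph with $m\ge 1$ edges, and let $k$ be the number of distinct paths in $H$ (paths are counted as subgraphs, i.e. without direction, and one-vertex paths are included). Let $G=(V,E)$ be a proper intersection graph of paths in some subdivision $H'$ of $H$; that is, $H'$ arises from $H$ by replacing each edge by a path with any number (possibly zero) of new inner vertices, and there are paths $P_v\subseteq H'$ ($v\in V$) such that $P_u\not\subseteq P_v$ for all distinct $u,v\in V$, and distinct $u,v$ are adjacent in $G$ if and only if $P_u$ and $P_v$ have a common vertex. Then $G$ is proper $(m^2k)$-mixed-thin. Here, for an integer $K>0$, the graph $G$ is *proper $K$-mixed-thin* if there exist a partition $(V_1,\dots,V_K)$ of $V$ (parts may be empty) and, for all $1\le i\le j\le K$, a linear order $\le_{ij}$ on $V_i\cup V_j$ and a choice of $E_{i,j}\in\{E,\bar E\}$, where $\bar E=\binom V2\setminus E$, such that for all $1\le i\le j\le K$: (a) the restriction of $\le_{ij}$ to $V_i$ is equal to $\le_{ii}$ or to the inverse of $\le_{ii}$, and the restriction of $\le_{ij}$ to $V_j$ is equal to $\le_{jj}$ or to the inverse of $\le_{jj}$; (b) for all $u,v,w$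 with ($u,v\in V_i$ and $w\in V_j$) or ($u,v\in V_j$ and $w\in V_i$): if $u<_{ij}v<_{ij}w$ and $uw\in E_{i,j}$, then $vw\in E_{i,j}$; (c) for all $u,v,w$ with ($v,w\in V_i$ and $u\in V_j$) or ($v,w\in V_j$ and $u\in V_i$): if $u<_{ij}v<_{ij}w$ and $uw\in E_{i,j}$, then $uv\in E_{i,j}$. -/

import Mathlib

/-! ### Proper mixed-thin graphs -/

/-- The relation `r` is a (non-strict) linear order on the set `s`. -/
structure IsLinearOrderOn {V : Type*} (s : Set V) (r : V → V → Prop) : Prop where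
  refl : ∀ u ∈ s, r u u
  antisymm : ∀ u ∈ s, ∀ v ∈ s, r u v → r v u → u = v
  trans : ∀ u ∈ s, ∀ v ∈ s, ∀ w ∈ s, r u v → r v w → r u w
  total : ∀ u ∈ s, ∀ v ∈ s, r u v ∨ r v u

/-- On the set `s`, the relations `r` and `r'` are the same, or one is the inverse of the other. -/
def AlignedOn {V : Type*} (s : Set V) (r r' : V → V → Prop) : Prop :=
  (∀ u ∈ s, ∀ v ∈ s, (r u v ↔ r' u v)) ∨ (∀ u ∈ s, ∀ v ∈ s, (r u v ↔ r' v u))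

/-- The graph `G` is proper `k`-mixed-thin. The parts are `V_i = {v | part v = i}` (some of them
may be empty), `le i j` is the linear order on `V_i ∪ V_j`, and `E i j`, which is `G` or its
complement, is the chosen edge set. Only the pairs `i ≤ j` matter. -/
def IsProperMixedThin {V : Type*} (G : SimpleGraph V) (k : ℕ) : Prop :=
  0 < k ∧
  ∃ (part : V → Fin k) (le : Fin k → Fin k → V → V → Prop) (E : Fin k → Fin k → SimpleGraph V),
    ∀ i j : Fin k, i ≤ j →
      IsLinearOrderOn {v | part v = i ∨ part v = j} (le i j) ∧
      (E i j = G ∨ E i j = Gᶜ) ∧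
      -- (a)
      AlignedOn {v | part v = i} (le i j) (le i i) ∧
      AlignedOn {v | part v = j} (le i j) (le j j) ∧
      -- (b)
      (∀ u v w : V,
        ((part u = i ∧ part v = i ∧ part w = j) ∨ (part u = j ∧ part v = j ∧ part w = i)) →
        (le i j u v ∧ u ≠ v) → (le i j v w ∧ v ≠ w) →
        (E i j).Adj u w → (E i j).Adj v w) ∧
      -- (c)
      (∀ u v w : V,
        ((part v = i ∧ part w = i ∧ part u = j) ∨ (part v = j ∧ part w = j ∧ part u = i)) →
        (le i j u v ∧ u ≠ v) → (le i j v w ∧ v ≠ w) →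
        (E i j).Adj u w → (E i j).Adj u v)

/-! ### Subdivisions -/

/-- The points in order along the edge `e` of `H` when `e` is subdivided by `n e` new vertices:
point `0` is one end of `e`, points `1, …, n e` are the new vertices on `e`, and point `n e + 1`
is the other end of `e`. (The direction in which `e` is traversed is chosen arbitrarily.) -/
noncomputable def subdivPoint {W : Type*} (H : SimpleGraph W) (n : H.edgeSet → ℕ)
    (e : H.edgeSet) : ℕ → W ⊕ (Σ e : H.edgeSet, Fin (n e))
  | 0 => Sum.inl (Quot.out e.1).1
  | i + 1 => if h : i < n e then Sum.inr ⟨e, ⟨i, h⟩⟩ else Sum.inl (Quot.out e.1).2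

/-- The graph obtained from `H` by replacing every edge `e` by a path with `n e` inner vertices,
that is, by subdividing `e` repeatedly, `n e` times in total. -/
noncomputable def subdivGraph {W : Type*} (H : SimpleGraph W) (n : H.edgeSet → ℕ) :
    SimpleGraph (W ⊕ (Σ e : H.edgeSet, Fin (n e))) :=
  SimpleGraph.fromRel fun x y =>
    ∃ e : H.edgeSet, ∃ i ≤ n e, x = subdivPoint H n e i ∧ y = subdivPoint H n e (i + 1)

/-- `H'` is (isomorphic to) a subdivision of `H`. -/
def IsSubdivision {W W' : Type*} (H : SimpleGraph W) (H' : SimpleGraph W') : Prop :=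
  ∃ n : H.edgeSet → ℕ, Nonempty (H' ≃g subdivGraph H n)

/-! ### Paths and intersection graphs of paths -/

/-- The subgraph `P` is a path (one-vertex paths included). -/
def IsPathSubgraph {W : Type*} {H : SimpleGraph W} (P : H.Subgraph) : Prop :=
  ∃ (u v : W) (p : H.Walk u v), p.IsPath ∧ P = p.toSubgraph

/-- The number of distinct paths in `H`; paths are counted as subgraphs, so a path and its
reverse are the same. -/
noncomputable def numPaths {W : Type*} (H : SimpleGraph W) : ℕ :=
  {P : H.Subgraph | IsPathSubgraph P}.ncard

/-- `G` is a proper intersection graph of paths in `H'`: the vertices of `G` are represented by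
paths in `H'` none of which is contained in another one, and two vertices are adjacent exactly
when their paths intersect. -/
def IsProperPathIntersectionGraph {V W' : Type*} (G : SimpleGraph V) (H' : SimpleGraph W') :
    Prop :=
  ∃ P : V → H'.Subgraph,
    (∀ v, IsPathSubgraph (P v)) ∧
    (∀ u v, u ≠ v → (G.Adj u v ↔ ((P u).verts ∩ (P v).verts).Nonempty)) ∧
    (∀ u v, u ≠ v → ¬ P u ≤ P v)

/-! A path of the subdivision is of one of two kinds. Either it stays among the inner vertices of
one edge of `H` (`IsInner`), or it is the subdivision of a path Q of `H` with two tails, which leave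
the ends of Q along edges of `H` and stop before the next vertex of `H` (`IsTailed`); see
`SimpleGraph.Walk.IsPath.inner_or_tailed`. Label a tailed path by its two tail edges and Q; label an
inner path by its edge, taken twice, and the one-edge path on it. This gives m·m·k labels, whose
classes are the parts. No class mixes the two kinds, since a tailed path with the label of an inner
path contains it (`forall_isInner_or_forall_isTailed`).

Each path in a class is determined by two numbers a, b: tail lengths or positions of the ends. As no
path contains another, b decreases with a in a tailed class and increases with a in an inner one. So
a orders the class, and moving along this order moves both parameters monotonically. A tailed class
is a clique; an inner class is a proper interval graph.

For two tailed classes whose paths Q meet, all pairs are adjacent. Otherwise members can only meet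
where tails approach each other on one edge, so non-adjacency is a conjunction of four conditional
linear inequalities. At most two of them are ever nontrivial (`mergeable_tailed_tailed`; similarly
`mergeable_inner_tailed`). With one of the orders reversed if necessary, these two conditions A and
B are monotone in opposite directions. Interleaving the two orders according to A makes (b) and (c)
follow from B (`Mergeable.exists_goodOrder`). -/

open SimpleGraph

/-! ### Coordinates along the oriented edges of a subdivision -/

section Points

variable {W : Type*} {H : SimpleGraph W} (n : H.edgeSet → ℕ)

/-- The number of inner vertices on the subdivided edge underlying a dart. -/
def dartInner (d : H.Dart) : ℕ := n ⟨d.edge, d.edge_mem⟩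

/-- The points in order along a dart. -/
noncomputable def dartPoint (d : H.Dart) (i : ℕ) : W ⊕ (Σ e : H.edgeSet, Fin (n e)) :=
  open Classical in
  if (Quot.out d.edge).1 = d.fst then subdivPoint H n ⟨d.edge, d.edge_mem⟩ i
  else subdivPoint H n ⟨d.edge, d.edge_mem⟩ (dartInner n d + 1 - i)

@[simp] lemma dartInner_symm (d : H.Dart) : dartInner n d.symm = dartInner n d := by
  simp only [dartInner, Dart.edge_symm]

lemma out_edge_cases (d : H.Dart) :
    ((Quot.out d.edge).1 = d.fst ∧ (Quot.out d.edge).2 = d.snd) ∨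
      ((Quot.out d.edge).1 = d.snd ∧ (Quot.out d.edge).2 = d.fst) := by
  have h : s((Quot.out d.edge).1, (Quot.out d.edge).2) = s(d.fst, d.snd) := Quot.out_eq d.edge
  simpa only [Sym2.eq_iff] using h

lemma subdivPoint_inner (e : H.edgeSet) {i : ℕ} (h : i < n e) :
    subdivPoint H n e (i + 1) = Sum.inr ⟨e, ⟨i, h⟩⟩ := by
  simp [subdivPoint, h]

lemma subdivPoint_last (e : H.edgeSet) :
    subdivPoint H n e (n e + 1) = Sum.inl (Quot.out e.1).2 := by
  simp [subdivPoint]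

lemma dartPoint_zero (d : H.Dart) : dartPoint n d 0 = Sum.inl d.fst := by
  unfold dartPoint
  split_ifs with h
  · simp [subdivPoint, h]
  · rcases out_edge_cases d with h' | h'
    · exact absurd h'.1 h
    · rw [← h'.2]
      exact subdivPoint_last n _

lemma dartPoint_symm (d : H.Dart) {i : ℕ} (hi : i ≤ dartInner n d + 1) :
    dartPoint n d.symm i = dartPoint n d (dartInner n d + 1 - i) := by
  have hne : d.fst ≠ d.snd := d.adj.ne
  rcases out_edge_cases d with h | h
  · simp [dartPoint, h.1, hne]
  · simp [dartPoint, h.1, hne.symm]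
    congr 1
    omega

lemma dartPoint_last (d : H.Dart) : dartPoint n d (dartInner n d + 1) = Sum.inl d.snd := by
  have := dartPoint_symm n d (Nat.zero_le _)
  rw [dartPoint_zero] at this
  simpa using this.symm

/-- An inner point of a dart, in coordinates. -/
lemma dartPoint_inner (d : H.Dart) {i : ℕ} (h1 : 1 ≤ i) (h2 : i ≤ dartInner n d) :
    ∃ j : Fin (dartInner n d), dartPoint n d i = Sum.inr ⟨⟨d.edge, d.edge_mem⟩, j⟩ ∧
      (((Quot.out d.edge).1 = d.fst ∧ j + 1 = i) ∨
        ((Quot.out d.edge).1 = d.snd ∧ j + i = dartInner n d)) := by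
  classical
  unfold dartPoint
  split_ifs with h
  · refine ⟨⟨i - 1, by omega⟩, ?_, Or.inl ⟨h, Nat.sub_add_cancel h1⟩⟩
    obtain ⟨i, rfl⟩ := Nat.exists_eq_add_of_le' h1
    exact subdivPoint_inner n _ (by simpa [dartInner] using h2)
  · refine ⟨⟨dartInner n d - i, by omega⟩, ?_, Or.inr ⟨?_, Nat.sub_add_cancel h2⟩⟩
    swap
    · exact (out_edge_cases d).elim (fun h' => absurd h'.1 h) (fun h' => h'.1)
    have : dartInner n d + 1 - i = dartInner n d - i + 1 := by omega
    rw [this]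
    exact subdivPoint_inner n _ _

lemma dartPoint_eq_inl {d : H.Dart} {i : ℕ} (hi : i ≤ dartInner n d + 1) {x : W}
    (h : dartPoint n d i = Sum.inl x) :
    (i = 0 ∧ d.fst = x) ∨ (i = dartInner n d + 1 ∧ d.snd = x) := by
  rcases Nat.eq_zero_or_pos i with rfl | h1
  · rw [dartPoint_zero] at h
    exact Or.inl ⟨rfl, Sum.inl.inj h⟩
  rcases Nat.lt_or_ge (dartInner n d) i with h2 | h2
  · obtain rfl : i = dartInner n d + 1 := by omega
    rw [dartPoint_last] at h
    exact Or.inr ⟨rfl, Sum.inl.inj h⟩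
  · obtain ⟨j, hj, -⟩ := dartPoint_inner n d h1 h2
    rw [hj] at h
    cases h

/-- An inner point determines its edge, hence its dart up to reversal, and reversal sends position
`i` to `dartInner n d + 1 - i`. -/
lemma dartPoint_inner_inj {d d' : H.Dart} {i j : ℕ} (h1 : 1 ≤ i) (h2 : i ≤ dartInner n d)
    (hj : j ≤ dartInner n d' + 1) (h : dartPoint n d i = dartPoint n d' j) :
    (d' = d ∧ j = i) ∨ (d' = d.symm ∧ i + j = dartInner n d + 1) := by
  obtain ⟨k, hk, hk'⟩ := dartPoint_inner n d h1 h2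
  have h3 : 1 ≤ j := by
    by_contra h0
    obtain rfl : j = 0 := by omega
    rw [hk, dartPoint_zero] at h
    cases h
  have h4 : j ≤ dartInner n d' := by
    by_contra h0
    obtain rfl : j = dartInner n d' + 1 := by omega
    rw [hk, dartPoint_last] at h
    cases h
  obtain ⟨l, hl, hl'⟩ := dartPoint_inner n d' h3 h4
  rw [hk, hl] at h
  have h5 := Sum.inr.inj h
  have he : d.edge = d'.edge := congrArg (fun z => z.1.1) h5
  have hv : (k : ℕ) = l := congrArg (fun z => (z.2 : ℕ)) h5
  have hne : d.fst ≠ d.snd := d.adj.ne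
  rcases (dart_edge_eq_iff d d').1 he with rfl | rfl
  · left
    refine ⟨rfl, ?_⟩
    rcases hk' with ⟨e1, hk'⟩ | ⟨e1, hk'⟩ <;> rcases hl' with ⟨e2, hl'⟩ | ⟨e2, hl'⟩
    · omega
    · exact absurd (e1.symm.trans e2) hne
    · exact absurd (e2.symm.trans e1) hne
    · omega
  · right
    refine ⟨by simp, ?_⟩
    simp only [dartInner_symm, Dart.edge_symm] at *
    rcases hk' with ⟨e1, hk'⟩ | ⟨e1, hk'⟩ <;> rcases hl' with ⟨e2, hl'⟩ | ⟨e2, hl'⟩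
    · exact absurd (e1.symm.trans e2) hne
    · omega
    · omega
    · exact absurd (e2.symm.trans e1) hne

lemma dartPoint_inj {d : H.Dart} {i j : ℕ} (hi : i ≤ dartInner n d + 1)
    (hj : j ≤ dartInner n d + 1) (h : dartPoint n d i = dartPoint n d j) : i = j := by
  have hne : d.fst ≠ d.snd := d.adj.ne
  have hs : d ≠ d.symm := d.symm_ne.symm
  by_cases h1 : 1 ≤ i ∧ i ≤ dartInner n d
  · rcases dartPoint_inner_inj n h1.1 h1.2 hj h with h | h
    · exact h.2.symm
    · exact absurd h.1 hs
  by_cases h2 : i = 0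
  · subst h2
    rw [dartPoint_zero] at h
    rcases dartPoint_eq_inl n hj h.symm with h | h
    · exact h.1.symm
    · exact absurd h.2.symm hne
  · obtain rfl : i = dartInner n d + 1 := by omega
    rw [dartPoint_last] at h
    rcases dartPoint_eq_inl n hj h.symm with h | h
    · exact absurd h.2 hne
    · exact h.1.symm

lemma adj_dartPoint (d : H.Dart) {i : ℕ} (hi : i ≤ dartInner n d) :
    (subdivGraph H n).Adj (dartPoint n d i) (dartPoint n d (i + 1)) := by
  classical
  have hne : dartPoint n d i ≠ dartPoint n d (i + 1) := fun h => by
    have := dartPoint_inj n (by omega) (by omega) h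
    omega
  rw [subdivGraph, fromRel_adj]
  refine ⟨hne, ?_⟩
  unfold dartPoint
  split_ifs with h
  · exact Or.inl ⟨_, i, hi, rfl, rfl⟩
  · refine Or.inr ⟨_, dartInner n d - i, Nat.sub_le _ _, ?_, ?_⟩
    · congr 1
      omega
    · congr 1
      omega

/-- A dart with a given underlying edge along which `subdivPoint` runs. -/
lemma exists_dart_subdivPoint (e : H.edgeSet) :
    ∃ d : H.Dart, d.edge = e.1 ∧ dartInner n d = n e ∧
      ∀ i, dartPoint n d i = subdivPoint H n e i := by
  have he : s((Quot.out e.1).1, (Quot.out e.1).2) = e.1 := Quot.out_eq e.1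
  have ha : H.Adj (Quot.out e.1).1 (Quot.out e.1).2 := by
    rw [← mem_edgeSet, he]
    exact e.2
  refine ⟨⟨_, ha⟩, he, ?_, fun i => ?_⟩
  · simp only [dartInner]
    congr 1
    exact Subtype.ext he
  · have : (⟨(⟨_, ha⟩ : H.Dart).edge, Dart.edge_mem _⟩ : H.edgeSet) = e := Subtype.ext he
    have h2 : (⟨_, ha⟩ : H.Dart).edge = e.1 := he
    simp [dartPoint, h2]

lemma exists_dart_of_adj {x y : W ⊕ (Σ e : H.edgeSet, Fin (n e))}
    (h : (subdivGraph H n).Adj x y) :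
    ∃ d : H.Dart, ∃ i ≤ dartInner n d, x = dartPoint n d i ∧ y = dartPoint n d (i + 1) := by
  rw [subdivGraph, fromRel_adj] at h
  rcases h with ⟨-, ⟨e, i, hi, rfl, rfl⟩ | ⟨e, i, hi, rfl, rfl⟩⟩
  · obtain ⟨d, -, hd, hp⟩ := exists_dart_subdivPoint n e
    exact ⟨d, i, hd ▸ hi, (hp _).symm, (hp _).symm⟩
  · obtain ⟨d, -, hd, hp⟩ := exists_dart_subdivPoint n e
    rw [← hd] at hi
    refine ⟨d.symm, dartInner n d - i, by simp, ?_, ?_⟩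
    · rw [dartPoint_symm n d (by omega), ← hp]
      congr 1
      omega
    · rw [dartPoint_symm n d (by omega), ← hp]
      congr 1
      omega

lemma exists_dartPoint_of_inr (z : Σ e : H.edgeSet, Fin (n e)) :
    ∃ d : H.Dart, ∃ i, 1 ≤ i ∧ i ≤ dartInner n d ∧ Sum.inr z = dartPoint n d i := by
  obtain ⟨e, j⟩ := z
  obtain ⟨d, -, hd, hp⟩ := exists_dart_subdivPoint n e
  exact ⟨d, j + 1, by omega, by have := j.2; omega, by rw [hp, subdivPoint_inner n e j.2]⟩

end Points

/-! ### Segments, subdivided subgraphs and the shape of paths -/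

section Decomposition

variable {W : Type*} {H : SimpleGraph W} (n : H.edgeSet → ℕ)

lemma SimpleGraph.Subgraph.le_of_verts_of_adj {V : Type*} {G : SimpleGraph V} {P P' : G.Subgraph}
    (hv : ∀ x ∈ P.verts, x ∈ P'.verts) (ha : ∀ x y, P.Adj x y → P'.Adj x y) : P ≤ P' :=
  ⟨hv, fun {x y} => ha x y⟩

/-- The subgraph formed by the points `l, …, r` along a dart. -/
def dartSegment (d : H.Dart) (l r : ℕ) : (subdivGraph H n).Subgraph where
  verts := {z | ∃ i, l ≤ i ∧ i ≤ r ∧ z = dartPoint n d i}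
  -- Beyond position `dartInner n d + 1` the points repeat the far end; the last bound keeps this
  -- from producing a loop.
  Adj x y := ∃ i, l ≤ i ∧ i + 1 ≤ r ∧ i ≤ dartInner n d ∧
    s(x, y) = s(dartPoint n d i, dartPoint n d (i + 1))
  adj_sub := by
    rintro x y ⟨i, -, -, hi, h⟩
    rw [← mem_edgeSet, h, mem_edgeSet]
    exact adj_dartPoint n d hi
  edge_vert := by
    rintro x y ⟨i, hl, hr, -, h⟩
    rcases Sym2.eq_iff.1 h with ⟨rfl, -⟩ | ⟨rfl, -⟩
    · exact ⟨i, hl, by omega, rfl⟩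
    · exact ⟨i + 1, by omega, hr, rfl⟩
  symm := ⟨by
    rintro x y ⟨i, hl, hr, hi, h⟩
    exact ⟨i, hl, hr, hi, by rw [Sym2.eq_swap, h]⟩⟩

/-- The subdivision of a subgraph of `H`. -/
def subdivSubgraph (Q : H.Subgraph) : (subdivGraph H n).Subgraph where
  verts := {z | (∃ x ∈ Q.verts, z = Sum.inl x) ∨
    ∃ d : H.Dart, Q.Adj d.fst d.snd ∧ ∃ i ≤ dartInner n d + 1, z = dartPoint n d i}
  Adj x y := ∃ d : H.Dart, Q.Adj d.fst d.snd ∧ ∃ i ≤ dartInner n d,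
    x = dartPoint n d i ∧ y = dartPoint n d (i + 1)
  adj_sub := by
    rintro x y ⟨d, -, i, hi, rfl, rfl⟩
    exact adj_dartPoint n d hi
  edge_vert := by
    rintro x y ⟨d, hd, i, hi, rfl, -⟩
    exact Or.inr ⟨d, hd, i, by omega, rfl⟩
  symm := ⟨by
    rintro x y ⟨d, hd, i, hi, rfl, rfl⟩
    refine ⟨d.symm, hd.symm, dartInner n d - i, by simp, ?_, ?_⟩
    · rw [dartPoint_symm n d (by omega)]
      congr 1
      omega
    · rw [dartPoint_symm n d (by omega)]
      congr 1
      omega⟩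

variable {n}

lemma inl_mem_subdivSubgraph {Q : H.Subgraph} {x : W} :
    Sum.inl x ∈ (subdivSubgraph n Q).verts ↔ x ∈ Q.verts := by
  constructor
  · rintro (⟨y, hy, h⟩ | ⟨d, hd, i, hi, h⟩)
    · cases h
      exact hy
    · rcases dartPoint_eq_inl n hi h.symm with ⟨-, rfl⟩ | ⟨-, rfl⟩
      · exact hd.fst_mem
      · exact hd.snd_mem
  · exact fun h => Or.inl ⟨x, h, rfl⟩

lemma dartPoint_mem_subdivSubgraph {Q : H.Subgraph} {d : H.Dart} {i : ℕ} (h1 : 1 ≤ i)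
    (h2 : i ≤ dartInner n d) :
    dartPoint n d i ∈ (subdivSubgraph n Q).verts ↔ Q.Adj d.fst d.snd := by
  constructor
  · rintro (⟨y, hy, h⟩ | ⟨d', hd, j, hj, h⟩)
    · rcases dartPoint_eq_inl n (by omega) h with ⟨h0, -⟩ | ⟨h0, -⟩ <;> omega
    · rcases dartPoint_inner_inj n h1 h2 hj h with ⟨rfl, -⟩ | ⟨rfl, -⟩
      · exact hd
      · exact hd.symm
  · exact fun h => Or.inr ⟨d, h, i, by omega, rfl⟩

lemma dartSegment_mono (d : H.Dart) {l l' r r' : ℕ} (hl : l' ≤ l) (hr : r ≤ r') :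
    dartSegment n d l r ≤ dartSegment n d l' r' := by
  constructor
  · rintro z ⟨i, h1, h2, rfl⟩
    exact ⟨i, by omega, by omega, rfl⟩
  · rintro x y ⟨i, h1, h2, h3, h⟩
    exact ⟨i, by omega, by omega, h3, h⟩

lemma dartSegment_le_symm (d : H.Dart) {l r : ℕ} (hr : r ≤ dartInner n d + 1) :
    dartSegment n d l r ≤
      dartSegment n d.symm (dartInner n d + 1 - r) (dartInner n d + 1 - l) := by
  have key : ∀ i ≤ dartInner n d + 1,
      dartPoint n d i = dartPoint n d.symm (dartInner n d + 1 - i) := fun i hi => by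
    rw [dartPoint_symm n d (by omega)]
    congr 1
    omega
  constructor
  · rintro z ⟨i, h1, h2, rfl⟩
    exact ⟨dartInner n d + 1 - i, by omega, by omega, key i (by omega)⟩
  · rintro x y ⟨i, h1, h2, h3, h⟩
    refine ⟨dartInner n d - i, by omega, by omega, by simp, ?_⟩
    have h4 : dartInner n d + 1 - i = dartInner n d - i + 1 := by omega
    rw [h, key i (by omega), key (i + 1) (by omega), Sym2.eq_swap, h4, Nat.add_sub_add_right]

lemma dartSegment_symm (d : H.Dart) {l r : ℕ} (hl : l ≤ r) (hr : r ≤ dartInner n d + 1) :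
    dartSegment n d l r =
      dartSegment n d.symm (dartInner n d + 1 - r) (dartInner n d + 1 - l) := by
  refine le_antisymm (dartSegment_le_symm d hr) ?_
  refine (dartSegment_le_symm d.symm (by simp)).trans (le_of_eq ?_)
  simp only [Dart.symm_symm, dartInner_symm]
  congr 1 <;> omega

lemma dartSegment_succ (d : H.Dart) {l r : ℕ} (hl : l ≤ r) (hr : r ≤ dartInner n d)
    {x y} (h : (subdivGraph H n).Adj x y) (hx : x = dartPoint n d (r + 1))
    (hy : y = dartPoint n d r) :
    dartSegment n d l (r + 1) = (subdivGraph H n).subgraphOfAdj h ⊔ dartSegment n d l r := by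
  subst hx hy
  refine le_antisymm (Subgraph.le_of_verts_of_adj ?_ ?_)
    (sup_le (Subgraph.le_of_verts_of_adj ?_ ?_) (dartSegment_mono d le_rfl (Nat.le_succ r)))
  · rintro z ⟨i, h1, h2, rfl⟩
    rcases Nat.lt_or_ge r i with h3 | h3
    · obtain rfl : i = r + 1 := by omega
      exact Or.inl (Or.inl rfl)
    · exact Or.inr ⟨i, h1, h3, rfl⟩
  · rintro x y ⟨i, h1, h2, h3, he⟩
    rcases Nat.lt_or_ge i r with h4 | h4
    · exact Or.inr ⟨i, h1, h4, h3, he⟩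
    · obtain rfl : i = r := by omega
      refine Or.inl ?_
      rw [subgraphOfAdj_adj, he, Sym2.eq_swap]
  · rintro z (rfl | rfl)
    · exact ⟨r + 1, by omega, le_rfl, rfl⟩
    · exact ⟨r, by omega, by omega, rfl⟩
  · intro x y h
    rw [subgraphOfAdj_adj] at h
    exact ⟨r, hl, le_rfl, hr, by rw [← h, Sym2.eq_swap]⟩

lemma dartSegment_self (d : H.Dart) (i : ℕ) :
    dartSegment n d i i = (subdivGraph H n).singletonSubgraph (dartPoint n d i) := by
  refine le_antisymm (Subgraph.le_of_verts_of_adj ?_ ?_) (Subgraph.le_of_verts_of_adj ?_ ?_)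
  · rintro z ⟨j, h1, h2, rfl⟩
    obtain rfl : j = i := by omega
    rfl
  · rintro x y ⟨j, h1, h2, -⟩
    omega
  · rintro z rfl
    exact ⟨i, le_rfl, le_rfl, rfl⟩
  · rintro x y h
    exact h.elim

lemma dartSegment_zero_le {Q : H.Subgraph} {d : H.Dart} (h : d.fst ∈ Q.verts) :
    dartSegment n d 0 0 ≤ subdivSubgraph n Q := by
  rw [dartSegment_self, dartPoint_zero]
  refine ⟨?_, ?_⟩
  · rintro z rfl
    exact inl_mem_subdivSubgraph.2 h
  · rintro x y h
    exact h.elim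

lemma dartSegment_le_subdivSubgraph {Q : H.Subgraph} {d : H.Dart} (hd : Q.Adj d.fst d.snd)
    {l r : ℕ} (hr : r ≤ dartInner n d + 1) : dartSegment n d l r ≤ subdivSubgraph n Q := by
  refine ⟨?_, ?_⟩
  · rintro z ⟨i, -, h2, rfl⟩
    exact Or.inr ⟨d, hd, i, by omega, rfl⟩
  · rintro x y ⟨i, -, -, h, he⟩
    rcases Sym2.eq_iff.1 he with ⟨rfl, rfl⟩ | ⟨rfl, rfl⟩
    · exact ⟨d, hd, i, h, rfl, rfl⟩
    · exact Subgraph.Adj.symm (G' := subdivSubgraph n Q) ⟨d, hd, i, h, rfl, rfl⟩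

lemma subdivSubgraph_mono {Q Q' : H.Subgraph} (h : Q ≤ Q') :
    subdivSubgraph n Q ≤ subdivSubgraph n Q' := by
  refine ⟨?_, ?_⟩
  · rintro z (⟨x, hx, rfl⟩ | ⟨d, hd, h'⟩)
    · exact Or.inl ⟨x, h.1 hx, rfl⟩
    · exact Or.inr ⟨d, h.2 hd, h'⟩
  · rintro x y ⟨d, hd, h'⟩
    exact ⟨d, h.2 hd, h'⟩

lemma subdivSubgraph_cons {x y : W} (q : H.Walk x y) (d : H.Dart) (hd : d.fst = x)
    {z : W} (hz : H.Adj z x) (hzd : d.snd = z) :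
    subdivSubgraph n (Walk.cons hz q).toSubgraph =
      dartSegment n d 0 (dartInner n d + 1) ⊔ subdivSubgraph n q.toSubgraph := by
  have hda : (Walk.cons hz q).toSubgraph.Adj d.fst d.snd := by
    subst hd hzd
    exact Or.inl (by simp [subgraphOfAdj_adj, Sym2.eq_swap])
  have hmem : ∀ c : H.Dart, (Walk.cons hz q).toSubgraph.Adj c.fst c.snd →
      c = d ∨ c = d.symm ∨ q.toSubgraph.Adj c.fst c.snd := by
    subst hd hzd
    rintro c (h | h)
    · rw [subgraphOfAdj_adj, Sym2.eq_iff] at h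
      rcases h with ⟨h1, h2⟩ | ⟨h1, h2⟩
      · exact Or.inr (Or.inl (Dart.ext _ _ (Prod.ext h1.symm h2.symm)))
      · exact Or.inl (Dart.ext _ _ (Prod.ext h2.symm h1.symm))
    · exact Or.inr (Or.inr h)
  have hle : q.toSubgraph ≤ (Walk.cons hz q).toSubgraph := le_sup_right
  refine le_antisymm (Subgraph.le_of_verts_of_adj ?_ ?_)
    (sup_le (dartSegment_le_subdivSubgraph hda le_rfl)
    (subdivSubgraph_mono hle))
  · rintro v (⟨w, hw, rfl⟩ | ⟨c, hc, i, hi, rfl⟩)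
    · rcases hw with (rfl | rfl) | hw
      · exact Or.inl ⟨_, Nat.zero_le _, le_rfl, by rw [dartPoint_last, hzd]⟩
      · exact Or.inl ⟨0, Nat.zero_le _, Nat.zero_le _, by rw [dartPoint_zero, hd]⟩
      · exact Or.inr (Or.inl ⟨w, hw, rfl⟩)
    · rcases hmem c hc with rfl | rfl | hc
      · exact Or.inl ⟨i, Nat.zero_le _, hi, rfl⟩
      · rw [dartInner_symm] at hi
        exact Or.inl ⟨_, Nat.zero_le _, Nat.sub_le _ _, dartPoint_symm n d hi⟩
      · exact Or.inr (Or.inr ⟨c, hc, i, hi, rfl⟩)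
  · rintro u v ⟨c, hc, i, hi, rfl, rfl⟩
    have hcadj : (dartSegment n c 0 (dartInner n c + 1)).Adj (dartPoint n c i)
      (dartPoint n c (i + 1)) := ⟨i, Nat.zero_le _, by omega, hi, rfl⟩
    rcases hmem c hc with rfl | rfl | hc
    · exact Or.inl hcadj
    · rw [dartSegment_symm _ (Nat.zero_le _) le_rfl] at hcadj
      exact Or.inl (by simpa using hcadj)
    · exact Or.inr ⟨c, hc, i, hi, rfl, rfl⟩

lemma subdivSubgraph_nil (d : H.Dart) :
    subdivSubgraph n (Walk.nil' (G := H) d.fst).toSubgraph = dartSegment n d 0 0 := by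
  refine le_antisymm ?_ (dartSegment_zero_le (by simp))
  rw [dartSegment_self, dartPoint_zero]
  refine ⟨?_, ?_⟩
  · rintro z (⟨x, hx, rfl⟩ | ⟨c, hc, -⟩)
    · cases hx
      rfl
    · exact hc.elim
  · rintro u v ⟨c, hc, -⟩
    exact hc.elim

variable (n)

/-- A path of the subdivision that stays inside an edge of `H` and ends at a given vertex. -/
def IsInnerFrom (P : (subdivGraph H n).Subgraph) (s : W ⊕ (Σ e : H.edgeSet, Fin (n e))) : Prop :=
  ∃ (c : H.Dart) (l r : ℕ), 1 ≤ l ∧ l ≤ r ∧ r ≤ dartInner n c ∧ s = dartPoint n c r ∧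
    P = dartSegment n c l r

/-- A path of the subdivision consisting of a subdivided path of `H` and two tails along the darts
`d` and `d'`, of which the first one ends at a given vertex. -/
def IsTailedFrom (P : (subdivGraph H n).Subgraph) (s : W ⊕ (Σ e : H.edgeSet, Fin (n e))) :
    Prop :=
  ∃ (x y : W) (q : H.Walk x y) (d d' : H.Dart) (a b : ℕ), q.IsPath ∧ d.fst = x ∧ d'.fst = y ∧
    a ≤ dartInner n d ∧ b ≤ dartInner n d' ∧ (d = d' → a = 0 ∨ b = 0) ∧ s = dartPoint n d a ∧
    P = dartSegment n d 0 a ⊔ subdivSubgraph n q.toSubgraph ⊔ dartSegment n d' 0 b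

variable {n}

/-- The new vertex either prolongs the segment within its edge or is an end of that edge. In the
latter case it becomes a one-vertex path of `H` with the old segment as a tail. -/
lemma IsInnerFrom.cons {P : (subdivGraph H n).Subgraph} {s t} (hP : IsInnerFrom n P s)
    (h : (subdivGraph H n).Adj t s) (ht : t ∉ P.verts) :
    IsInnerFrom n ((subdivGraph H n).subgraphOfAdj h ⊔ P) t ∨
      IsTailedFrom n ((subdivGraph H n).subgraphOfAdj h ⊔ P) t := by
  obtain ⟨c, l, r, hl, hlr, hr, hs, rfl⟩ := hP
  obtain ⟨g, i, hi, hsg, htg⟩ := exists_dart_of_adj n h.symm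
  obtain ⟨l, r, hl, hlr, hr, hs, hPg, rfl⟩ : ∃ l' r', 1 ≤ l' ∧ l' ≤ r' ∧ r' ≤ dartInner n g ∧
      s = dartPoint n g r' ∧ dartSegment n c l r = dartSegment n g l' r' ∧ i = r' := by
    -- A step against `c` would return to point `r - 1`, which is already on the path unless the
    -- path is a single point; then `c` can be reversed.
    rcases dartPoint_inner_inj n (hl.trans hlr) hr (by omega) (hs.symm.trans hsg) with
      ⟨rfl, rfl⟩ | ⟨rfl, hri⟩
    · exact ⟨l, i, hl, hlr, hr, hs, rfl, rfl⟩
    · rw [dartInner_symm] at hi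
      rcases Nat.lt_or_ge l r with hlt | hge
      · refine absurd ⟨r - 1, by omega, by omega, ?_⟩ ht
        rw [htg, dartPoint_symm n c (by omega)]
        congr 1
        omega
      · obtain rfl : l = r := by omega
        refine ⟨i, i, by omega, le_rfl, by simpa using hi, hsg, ?_, rfl⟩
        rw [dartSegment_symm c le_rfl (by omega)]
        congr 1 <;> omega
  rw [hPg, ← dartSegment_succ g hlr hr h htg hs]
  rcases Nat.lt_or_ge i (dartInner n g) with hlt | hge
  · exact Or.inl ⟨g, l, i + 1, hl, by omega, hlt, htg, rfl⟩
  · obtain rfl : i = dartInner n g := by omega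
    refine Or.inr ⟨g.snd, g.snd, Walk.nil, g.symm, g.symm, 0, dartInner n g + 1 - l,
      Walk.IsPath.nil, rfl, rfl, Nat.zero_le _, ?_, fun _ => Or.inl rfl, ?_, ?_⟩
    · rw [dartInner_symm]
      omega
    · rw [htg, dartPoint_last, dartPoint_zero]
      rfl
    · rw [dartSegment_symm g (by omega) le_rfl]
      have := subdivSubgraph_nil (n := n) g.symm
      change subdivSubgraph n (Walk.nil' (G := H) g.snd).toSubgraph = _ at this
      change _ = _ ⊔ subdivSubgraph n (Walk.nil' (G := H) g.snd).toSubgraph ⊔ _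
      rw [this, sup_idem, Nat.sub_self]
      exact (sup_eq_right.2 (dartSegment_mono _ le_rfl (Nat.zero_le _))).symm

/-- The first tail grows by one point until it reaches the next vertex of `H`; then its whole edge
is absorbed into `q` and a tail of length 0 remains. -/
lemma IsTailedFrom.cons {P : (subdivGraph H n).Subgraph} {s t} (hP : IsTailedFrom n P s)
    (h : (subdivGraph H n).Adj t s) (ht : t ∉ P.verts) :
    IsTailedFrom n ((subdivGraph H n).subgraphOfAdj h ⊔ P) t := by
  obtain ⟨x, y, q, d, d', a, b, hq, hd, hd', ha, hb, hab, hs, rfl⟩ := hP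
  obtain ⟨g, i, hi, hsg, htg⟩ := exists_dart_of_adj n h.symm
  have hxq : x ∈ q.toSubgraph.verts := by simp
  obtain ⟨hgx, hPg, hib⟩ : g.fst = x ∧ dartSegment n d 0 a ⊔ subdivSubgraph n q.toSubgraph =
      dartSegment n g 0 i ⊔ subdivSubgraph n q.toSubgraph ∧ (g = d' → b = 0) := by
    rcases Nat.eq_zero_or_pos a with rfl | ha0
    · rw [dartPoint_zero, hd] at hs
      rcases dartPoint_eq_inl n (by omega) (hsg.symm.trans hs) with ⟨rfl, hg⟩ | ⟨h1, -⟩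
      · refine ⟨hg, ?_, ?_⟩
        · rw [sup_eq_right.2 (dartSegment_zero_le (by rwa [hd])),
            sup_eq_right.2 (dartSegment_zero_le (by rwa [hg]))]
        -- A new tail along the same dart as a nonempty second tail would begin with a vertex
        -- already on the path.
        · rintro rfl
          by_contra hb0
          exact ht (Or.inr ⟨1, by omega, by omega, htg⟩)
      · omega
    · rcases dartPoint_inner_inj n ha0 ha (by omega) (hs.symm.trans hsg) with
        ⟨rfl, rfl⟩ | ⟨rfl, hai⟩
      · exact ⟨hd, rfl, fun h => (hab h).resolve_left (by omega)⟩
      · rw [dartInner_symm] at hi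
        refine absurd (Or.inl (Or.inl ⟨a - 1, by omega, by omega, ?_⟩)) ht
        rw [htg, dartPoint_symm n d (by omega)]
        congr 1
        omega
  rw [hPg] at ht ⊢
  rw [← sup_assoc, ← sup_assoc, ← dartSegment_succ g (Nat.zero_le i) hi h htg hsg]
  rcases Nat.lt_or_ge i (dartInner n g) with hlt | hge
  · exact ⟨x, y, q, g, d', i + 1, b, hq, hgx, hd', hlt, hb, fun h => Or.inr (hib h), htg, rfl⟩
  · obtain rfl : i = dartInner n g := by omega
    subst hgx
    rw [dartPoint_last] at htg
    subst htg
    have hns : g.snd ∉ q.support := fun h' =>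
      ht (Or.inl (Or.inr (inl_mem_subdivSubgraph.2 (by simpa using h'))))
    -- The new tail is empty, so any dart leaving `g.snd` would serve; `g.symm` is at hand.
    refine ⟨g.snd, y, Walk.cons g.adj.symm q, g.symm, d', 0, b, hq.cons hns, rfl, hd',
      Nat.zero_le _, hb, fun _ => Or.inl rfl, ?_, ?_⟩
    · rw [dartPoint_zero]
      rfl
    · have hz : dartSegment n g.symm 0 0 ≤
          subdivSubgraph n (Walk.cons g.adj.symm q).toSubgraph :=
        dartSegment_zero_le (by simp)
      rw [sup_eq_right.2 hz, subdivSubgraph_cons q g rfl g.adj.symm rfl]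

/-- Every path of a subdivision lies inside an edge or is a subdivided path with two tails. -/
lemma SimpleGraph.Walk.IsPath.inner_or_tailed (hdart : ∀ x : W, ∃ d : H.Dart, d.fst = x) {s t}
    (p : (subdivGraph H n).Walk s t) (hp : p.IsPath) :
    IsInnerFrom n p.toSubgraph s ∨ IsTailedFrom n p.toSubgraph s := by
  induction p with
  | @nil u =>
    rcases u with x | z
    · right
      obtain ⟨d, rfl⟩ := hdart x
      refine ⟨d.fst, d.fst, Walk.nil, d, d, 0, 0, Walk.IsPath.nil, rfl, rfl, Nat.zero_le _,
        Nat.zero_le _, fun _ => Or.inl rfl, (dartPoint_zero n d).symm, ?_⟩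
      have := subdivSubgraph_nil (n := n) d
      change subdivSubgraph n (Walk.nil : H.Walk d.fst d.fst).toSubgraph = _ at this
      rw [this, sup_idem, sup_idem, dartSegment_self, dartPoint_zero]
      rfl
    · left
      obtain ⟨d, i, h1, h2, h⟩ := exists_dartPoint_of_inr n z
      refine ⟨d, i, i, h1, le_rfl, h2, h, ?_⟩
      rw [dartSegment_self, ← h]
      rfl
  | cons h p ih =>
    rw [Walk.cons_isPath_iff] at hp
    have ht := hp.2
    rw [← Walk.mem_verts_toSubgraph] at ht
    rcases ih hp.1 with h' | h'
    · exact h'.cons h ht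
    · exact Or.inr (h'.cons h ht)

end Decomposition

/-! ### Interleaving two ordered classes -/

section Merge

variable {V : Type*}

/-- The edges between `X` and `Y` in `G` or in its complement are those satisfying `A` and `B`,
where `A` is preserved by moving down in `X` and up in `Y`, and `B` by moving up in `X` and down in
`Y`, with `X` and `Y` ordered by `key` or its opposite. -/
def Mergeable (G : SimpleGraph V) (key : V → ℤ) (X Y : Set V) : Prop :=
  ∃ (E : SimpleGraph V) (f g : V → ℤ) (A B : V → V → Prop), (E = G ∨ E = Gᶜ) ∧
    (f = key ∨ f = -key) ∧ (g = key ∨ g = -key) ∧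
    (∀ u ∈ X, ∀ v ∈ Y, E.Adj u v ↔ A u v ∧ B u v) ∧
    (∀ u ∈ X, ∀ u' ∈ X, ∀ v ∈ Y, ∀ v' ∈ Y, f u' ≤ f u → g v ≤ g v' → A u v → A u' v') ∧
    (∀ u ∈ X, ∀ u' ∈ X, ∀ v ∈ Y, ∀ v' ∈ Y, f u ≤ f u' → g v' ≤ g v → B u v → B u' v')

variable {G : SimpleGraph V} {key : V → ℤ} {X Y : Set V}

lemma Mergeable.symm (h : Mergeable G key X Y) : Mergeable G key Y X := by
  obtain ⟨E, f, g, A, B, hE, hf, hg, hAB, hA, hB⟩ := h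
  refine ⟨E, g, f, fun v u => B u v, fun v u => A u v, hE, hg, hf, fun v hv u hu => ?_, ?_, ?_⟩
  · rw [E.adj_comm, hAB u hu v hv, and_comm]
  · exact fun v hv v' hv' u hu u' hu' h1 h2 => hB u hu u' hu' v hv v' hv' h2 h1
  · exact fun v hv v' hv' u hu u' hu' h1 h2 => hA u hu u' hu' v hv v' hv' h2 h1

lemma Mergeable.of_forall_adj (h : ∀ u ∈ X, ∀ v ∈ Y, G.Adj u v) : Mergeable G key X Y :=
  ⟨G, key, key, fun _ _ => True, fun _ _ => True, Or.inl rfl, Or.inl rfl, Or.inl rfl,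
    fun u hu v hv => by simp [h u hu v hv], by simp, by simp⟩

lemma Mergeable.of_forall_not_adj (hXY : Disjoint X Y) (h : ∀ u ∈ X, ∀ v ∈ Y, ¬ G.Adj u v) :
    Mergeable G key X Y :=
  ⟨Gᶜ, key, key, fun _ _ => True, fun _ _ => True, Or.inr rfl, Or.inl rfl, Or.inl rfl,
    fun u hu v hv => by simp [h u hu v hv, hXY.ne_of_mem hu hv], by simp, by simp⟩

/-- The conditions of `IsProperMixedThin` on the pair of parts `X`, `Y`. -/
def GoodOrder (X Y : Set V) (r : V → V → Prop) (E : SimpleGraph V) : Prop :=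
  (∀ u v w : V, ((u ∈ X ∧ v ∈ X ∧ w ∈ Y) ∨ (u ∈ Y ∧ v ∈ Y ∧ w ∈ X)) →
    (r u v ∧ u ≠ v) → (r v w ∧ v ≠ w) → E.Adj u w → E.Adj v w) ∧
  (∀ u v w : V, ((v ∈ X ∧ w ∈ X ∧ u ∈ Y) ∨ (v ∈ Y ∧ w ∈ Y ∧ u ∈ X)) →
    (r u v ∧ u ≠ v) → (r v w ∧ v ≠ w) → E.Adj u w → E.Adj u v)

lemma alignedOn_of_key {r : V → V → Prop} {f : V → ℤ} (hf : f = key ∨ f = -key)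
    (hr : ∀ u ∈ X, ∀ v ∈ X, (r u v ↔ f u ≤ f v)) :
    AlignedOn X r (fun u v => key u ≤ key v) := by
  rcases hf with rfl | rfl
  · exact Or.inl hr
  · exact Or.inr fun u hu v hv => by simpa using hr u hu v hv

/-- Put `u ∈ X` before `v ∈ Y` exactly when `A u v`. Monotonicity of `A` makes this transitive, and
monotonicity of `B` carries edges of `E` to the pairs required by (b) and (c). -/
lemma Mergeable.exists_goodOrder (h : Mergeable G key X Y) (hXY : Disjoint X Y)
    (hX : Set.InjOn key X) (hY : Set.InjOn key Y) :
    ∃ (r : V → V → Prop) (E : SimpleGraph V), IsLinearOrderOn (X ∪ Y) r ∧ (E = G ∨ E = Gᶜ) ∧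
      AlignedOn X r (fun u v => key u ≤ key v) ∧ AlignedOn Y r (fun u v => key u ≤ key v) ∧
      GoodOrder X Y r E := by
  classical
  obtain ⟨E, f, g, A, B, hE, hf, hg, hAB, hA, hB⟩ := h
  have hfX : Set.InjOn f X := by
    rcases hf with rfl | rfl
    · exact hX
    · exact fun u hu v hv h => hX hu hv (neg_injective h)
  have hgY : Set.InjOn g Y := by
    rcases hg with rfl | rfl
    · exact hY
    · exact fun u hu v hv h => hY hu hv (neg_injective h)
  have hYX : ∀ v ∈ Y, v ∉ X := fun v hv hv' => hXY.ne_of_mem hv' hv rfl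
  let r : V → V → Prop := fun u v =>
    if u ∈ X then (if v ∈ X then f u ≤ f v else A u v)
    else (if v ∈ X then ¬ A v u else g u ≤ g v)
  have rXX : ∀ u ∈ X, ∀ v ∈ X, (r u v ↔ f u ≤ f v) := fun u hu v hv => by simp [r, hu, hv]
  have rXY : ∀ u ∈ X, ∀ v ∈ Y, (r u v ↔ A u v) := fun u hu v hv => by simp [r, hu, hYX v hv]
  have rYX : ∀ u ∈ Y, ∀ v ∈ X, (r u v ↔ ¬ A v u) := fun u hu v hv => by
    simp [r, hYX u hu, hv]
  have rYY : ∀ u ∈ Y, ∀ v ∈ Y, (r u v ↔ g u ≤ g v) := fun u hu v hv => by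
    simp [r, hYX u hu, hYX v hv]
  refine ⟨r, E, ⟨?_, ?_, ?_, ?_⟩, hE, alignedOn_of_key hf rXX, alignedOn_of_key hg rYY, ?_, ?_⟩
  · rintro u (hu | hu)
    · exact (rXX u hu u hu).2 le_rfl
    · exact (rYY u hu u hu).2 le_rfl
  · rintro u (hu | hu) v (hv | hv) h1 h2
    · exact hfX hu hv (le_antisymm ((rXX u hu v hv).1 h1) ((rXX v hv u hu).1 h2))
    · exact absurd ((rXY u hu v hv).1 h1) ((rYX v hv u hu).1 h2)
    · exact absurd ((rXY v hv u hu).1 h2) ((rYX u hu v hv).1 h1)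
    · exact hgY hu hv (le_antisymm ((rYY u hu v hv).1 h1) ((rYY v hv u hu).1 h2))
  · rintro u (hu | hu) v (hv | hv) w (hw | hw) h1 h2
    · rw [rXX u hu v hv] at h1; rw [rXX v hv w hw] at h2; rw [rXX u hu w hw]
      exact h1.trans h2
    · rw [rXX u hu v hv] at h1; rw [rXY v hv w hw] at h2; rw [rXY u hu w hw]
      exact hA v hv u hu w hw w hw h1 le_rfl h2
    · rw [rXY u hu v hv] at h1; rw [rYX v hv w hw] at h2; rw [rXX u hu w hw]
      by_contra hlt
      exact h2 (hA u hu w hw v hv v hv (le_of_not_ge hlt) le_rfl h1)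
    · rw [rXY u hu v hv] at h1; rw [rYY v hv w hw] at h2; rw [rXY u hu w hw]
      exact hA u hu u hu v hv w hw le_rfl h2 h1
    · rw [rYX u hu v hv] at h1; rw [rXX v hv w hw] at h2; rw [rYX u hu w hw]
      exact fun h => h1 (hA w hw v hv u hu u hu h2 le_rfl h)
    · rw [rYX u hu v hv] at h1; rw [rXY v hv w hw] at h2; rw [rYY u hu w hw]
      by_contra hlt
      exact h1 (hA v hv v hv w hw u hu le_rfl (le_of_not_ge hlt) h2)
    · rw [rYY u hu v hv] at h1; rw [rYX v hv w hw] at h2; rw [rYX u hu w hw]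
      exact fun h => h2 (hA w hw w hw u hu v hv le_rfl h1 h)
    · rw [rYY u hu v hv] at h1; rw [rYY v hv w hw] at h2; rw [rYY u hu w hw]
      exact h1.trans h2
  · rintro u (hu | hu) v (hv | hv)
    · rw [rXX u hu v hv, rXX v hv u hu]
      exact le_total _ _
    · rw [rXY u hu v hv, rYX v hv u hu]
      exact em _
    · rw [rYX u hu v hv, rXY v hv u hu]
      exact (em _).symm
    · rw [rYY u hu v hv, rYY v hv u hu]
      exact le_total _ _
  · rintro u v w (⟨hu, hv, hw⟩ | ⟨hu, hv, hw⟩) ⟨h1, -⟩ ⟨h2, -⟩ h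
    · rw [rXX u hu v hv] at h1; rw [rXY v hv w hw] at h2; rw [hAB u hu w hw] at h
      rw [hAB v hv w hw]
      exact ⟨h2, hB u hu v hv w hw w hw h1 le_rfl h.2⟩
    -- This case is vacuous: an edge of `E` needs `A`, so its end in `X` must come first.
    · rw [rYY u hu v hv] at h1; rw [rYX v hv w hw] at h2; rw [E.adj_comm, hAB w hw u hu] at h
      exact absurd (hA w hw w hw u hu v hv le_rfl h1 h.1) h2
  · rintro u v w (⟨hv, hw, hu⟩ | ⟨hv, hw, hu⟩) ⟨h1, -⟩ ⟨h2, -⟩ h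
    · rw [rYX u hu v hv] at h1; rw [rXX v hv w hw] at h2; rw [E.adj_comm, hAB w hw u hu] at h
      exact absurd (hA w hw v hv u hu u hu h2 le_rfl h.1) h1
    · rw [rXY u hu v hv] at h1; rw [rYY v hv w hw] at h2; rw [hAB u hu w hw] at h
      rw [hAB u hu v hv]
      exact ⟨h1, hB u hu u hu w hw v hv le_rfl h2 h.2⟩

/-- A labelling whose classes are pairwise mergeable shows proper mixed-thinness. -/
lemma isProperMixedThin_of_mergeable {L : Type*} {K : ℕ} (e : L ≃ Fin K) (hK : 0 < K)
    (lab : V → L) (hkey : ∀ c, Set.InjOn key {v | lab v = c})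
    (hsame : ∀ c, ∃ E : SimpleGraph V, (E = G ∨ E = Gᶜ) ∧
      GoodOrder {v | lab v = c} {v | lab v = c} (fun u v => key u ≤ key v) E)
    (hne : ∀ c c', c ≠ c' → Mergeable G key {v | lab v = c} {v | lab v = c'}) :
    IsProperMixedThin G K := by
  have main : ∀ i j : Fin K, ∃ (r : V → V → Prop) (E : SimpleGraph V),
      IsLinearOrderOn {v | e (lab v) = i ∨ e (lab v) = j} r ∧ (E = G ∨ E = Gᶜ) ∧
      AlignedOn {v | e (lab v) = i} r (fun u v => key u ≤ key v) ∧
      AlignedOn {v | e (lab v) = j} r (fun u v => key u ≤ key v) ∧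
      GoodOrder {v | e (lab v) = i} {v | e (lab v) = j} r E ∧
      -- Alignment compares each order with the diagonal ones, so the diagonal orders must be
      -- exactly the key order.
      (i = j → r = fun u v => key u ≤ key v) := by
    intro i j
    have hset : ∀ i, {v | e (lab v) = i} = {v | lab v = e.symm i} := fun i => by
      ext v
      simp [Equiv.eq_symm_apply]
    by_cases hij : i = j
    · subst hij
      obtain ⟨E, hE, hg⟩ := hsame (e.symm i)
      have hinj := hkey (e.symm i)
      rw [← hset] at hg hinj
      refine ⟨_, E, ⟨?_, ?_, ?_, ?_⟩, hE, Or.inl fun _ _ _ _ => Iff.rfl,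
        Or.inl fun _ _ _ _ => Iff.rfl, hg, fun _ => rfl⟩
      · exact fun _ _ => le_rfl
      · intro u hu v hv h1 h2
        exact hinj (or_self_iff.1 hu) (or_self_iff.1 hv) (le_antisymm h1 h2)
      · exact fun _ _ _ _ _ _ h1 h2 => h1.trans h2
      · exact fun _ _ _ _ => le_total _ _
    · have hne' : e.symm i ≠ e.symm j := fun h => hij (e.symm.injective h)
      obtain ⟨r, E, h1, h2, h3, h4, h5⟩ := (hne _ _ hne').exists_goodOrder
        (Set.disjoint_left.2 fun v h h' => hne' (Eq.trans (Eq.symm h) h'))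
        (hkey _) (hkey _)
      rw [← hset, ← hset] at h1 h5
      rw [← hset] at h3 h4
      exact ⟨r, E, h1, h2, h3, h4, h5, fun h => absurd h hij⟩
  choose r E h1 h2 h3 h4 h5 h6 using main
  refine ⟨hK, fun v => e (lab v), r, E, fun i j _ => ⟨h1 i j, h2 i j, ?_, ?_, (h5 i j).1,
    (h5 i j).2⟩⟩
  · rw [h6 i i rfl]
    exact h3 i j
  · rw [h6 j j rfl]
    exact h4 i j

end Merge

/-! ### When two paths of given shape are disjoint -/

section Intersection

variable {W : Type*} {H : SimpleGraph W} {n : H.edgeSet → ℕ}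

/-- Neither tail reaches the far end of its edge, so a common point is inner. The starts differ, so
the tails run towards each other on one edge, and they overlap once their lengths add up to at least
`dartInner n d + 1`. -/
lemma disjoint_tail_tail {d d' : H.Dart} {a a' : ℕ} (hne : d.fst ≠ d'.fst)
    (ha : a ≤ dartInner n d) (ha' : a' ≤ dartInner n d') :
    Disjoint (dartSegment n d 0 a).verts (dartSegment n d' 0 a').verts ↔
      (d = d'.symm → a + a' ≤ dartInner n d) := by
  rw [← not_iff_not, Set.not_disjoint_iff]
  push Not
  constructor
  · rintro ⟨z, ⟨i, -, hi, rfl⟩, ⟨j, -, hj, h⟩⟩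
    rcases Nat.eq_zero_or_pos i with rfl | hi0
    · rw [dartPoint_zero] at h
      rcases dartPoint_eq_inl n (by omega) h.symm with ⟨-, h⟩ | ⟨h, -⟩
      · exact absurd h.symm hne
      · omega
    · rcases dartPoint_inner_inj n hi0 (by omega) (by omega) h with ⟨rfl, -⟩ | ⟨rfl, h⟩
      · exact absurd rfl hne
      · exact ⟨by simp, by omega⟩
  · rintro ⟨rfl, h⟩
    rw [dartInner_symm] at h ha
    refine ⟨_, ⟨dartInner n d' + 1 - a', Nat.zero_le _, by omega, rfl⟩,
      ⟨a', Nat.zero_le _, le_rfl, ?_⟩⟩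
    rw [dartPoint_symm n d' (by omega)]
    congr 1
    omega

lemma disjoint_tail_subdiv {Q : H.Subgraph} {d : H.Dart} {a : ℕ} (hd : d.fst ∉ Q.verts)
    (ha : a ≤ dartInner n d) :
    Disjoint (dartSegment n d 0 a).verts (subdivSubgraph n Q).verts := by
  rw [Set.disjoint_left]
  rintro z ⟨i, -, hi, rfl⟩ hz
  rcases Nat.eq_zero_or_pos i with rfl | hi0
  · rw [dartPoint_zero, inl_mem_subdivSubgraph] at hz
    exact hd hz
  · rw [dartPoint_mem_subdivSubgraph hi0 (by omega)] at hz
    exact hd hz.fst_mem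

lemma disjoint_subdiv_subdiv {Q Q' : H.Subgraph} (h : Disjoint Q.verts Q'.verts) :
    Disjoint (subdivSubgraph n Q).verts (subdivSubgraph n Q').verts := by
  rw [Set.disjoint_left] at h ⊢
  rintro z (⟨x, hx, rfl⟩ | ⟨d, hd, i, hi, rfl⟩) hz
  · exact h hx (inl_mem_subdivSubgraph.1 hz)
  · by_cases hin : 1 ≤ i ∧ i ≤ dartInner n d
    · rw [dartPoint_mem_subdivSubgraph hin.1 hin.2] at hz
      exact h hd.fst_mem hz.fst_mem
    · rcases Nat.eq_zero_or_pos i with rfl | hi0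
      · rw [dartPoint_zero, inl_mem_subdivSubgraph] at hz
        exact h hd.fst_mem hz
      · obtain rfl : i = dartInner n d + 1 := by omega
        rw [dartPoint_last, inl_mem_subdivSubgraph] at hz
        exact h hd.snd_mem hz

lemma disjoint_inner_subdiv {Q : H.Subgraph} {c : H.Dart} {l r : ℕ} (hc : ¬ Q.Adj c.fst c.snd)
    (hl : 1 ≤ l) (hr : r ≤ dartInner n c) :
    Disjoint (dartSegment n c l r).verts (subdivSubgraph n Q).verts := by
  rw [Set.disjoint_left]
  rintro z ⟨i, h1, h2, rfl⟩ hz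
  exact hc ((dartPoint_mem_subdivSubgraph (by omega) (by omega)).1 hz)

lemma disjoint_inner_tail {c d : H.Dart} {l r a : ℕ} (hl : 1 ≤ l) (hlr : l ≤ r)
    (hr : r ≤ dartInner n c) (ha : a ≤ dartInner n d) :
    Disjoint (dartSegment n c l r).verts (dartSegment n d 0 a).verts ↔
      (d = c → a < l) ∧ (d = c.symm → a + r ≤ dartInner n c) := by
  constructor
  · rw [Set.disjoint_left]
    refine fun h => ⟨?_, ?_⟩
    · rintro rfl
      by_contra hlt
      exact h ⟨l, le_rfl, hlr, rfl⟩ ⟨l, Nat.zero_le _, by omega, rfl⟩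
    · rintro rfl
      by_contra hlt
      refine h ⟨r, hlr, le_rfl, rfl⟩ ⟨dartInner n c + 1 - r, Nat.zero_le _, by omega, ?_⟩
      rw [dartPoint_symm n c (by omega)]
      congr 1
      omega
  · rintro ⟨h1, h2⟩
    rw [Set.disjoint_left]
    rintro z ⟨i, hi1, hi2, rfl⟩ ⟨j, -, hj, h⟩
    rcases dartPoint_inner_inj n (by omega) (by omega) (by omega) h with ⟨he, rfl⟩ | ⟨he, hij⟩
    · have := h1 he
      omega
    · have := h2 he
      omega

lemma disjoint_inner_inner {c : H.Dart} {l r l' r' : ℕ} (hlr : l ≤ r)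
    (hr : r ≤ dartInner n c) (hlr' : l' ≤ r') (hr' : r' ≤ dartInner n c) :
    Disjoint (dartSegment n c l r).verts (dartSegment n c l' r').verts ↔ r < l' ∨ r' < l := by
  constructor
  · rw [Set.disjoint_left]
    intro h
    by_contra hlt
    exact h ⟨max l l', by omega, by omega, rfl⟩ ⟨max l l', by omega, by omega, rfl⟩
  · intro hlt
    rw [Set.disjoint_left]
    rintro z ⟨i, hi1, hi2, rfl⟩ ⟨j, hj1, hj2, h⟩
    have := dartPoint_inj n (by omega) (by omega) h
    omega

lemma disjoint_inner_inner_of_edge_ne {c c' : H.Dart} {l r l' r' : ℕ} (hc : c.edge ≠ c'.edge)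
    (hl : 1 ≤ l) (hr : r ≤ dartInner n c) (hr' : r' ≤ dartInner n c') :
    Disjoint (dartSegment n c l r).verts (dartSegment n c' l' r').verts := by
  rw [Set.disjoint_left]
  rintro z ⟨i, hi1, hi2, rfl⟩ ⟨j, hj1, hj2, h⟩
  rcases dartPoint_inner_inj n (by omega) (by omega) (by omega) h with ⟨rfl, -⟩ | ⟨rfl, -⟩
  · exact hc rfl
  · exact hc (Dart.edge_symm c).symm

/-- `P` is the part of the subdivided dart `c` between the inner points `l` and `r`. -/
structure IsInner (P : (subdivGraph H n).Subgraph) (c : H.Dart) (l r : ℕ) : Prop where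
  one_le : 1 ≤ l
  le : l ≤ r
  le_inner : r ≤ dartInner n c
  eq : P = dartSegment n c l r

/-- `P` is the subdivision of `Q` with tails of length `a` and `b` along the darts `d` and `d'`. -/
structure IsTailed (P : (subdivGraph H n).Subgraph) (Q : H.Subgraph) (d d' : H.Dart)
    (a b : ℕ) : Prop where
  fst_mem : d.fst ∈ Q.verts
  fst_mem' : d'.fst ∈ Q.verts
  le_inner : a ≤ dartInner n d
  le_inner' : b ≤ dartInner n d'
  eq_zero : d = d' → b = 0
  eq : P = dartSegment n d 0 a ⊔ subdivSubgraph n Q ⊔ dartSegment n d' 0 b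

lemma IsTailed.verts_eq {P : (subdivGraph H n).Subgraph} {Q d d' a b} (h : IsTailed P Q d d' a b) :
    P.verts = (dartSegment n d 0 a).verts ∪ (subdivSubgraph n Q).verts ∪
      (dartSegment n d' 0 b).verts := by
  rw [h.eq]
  rfl

lemma IsTailed.subdivSubgraph_le {P : (subdivGraph H n).Subgraph} {Q d d' a b}
    (h : IsTailed P Q d d' a b) : subdivSubgraph n Q ≤ P := by
  rw [h.eq]
  exact le_sup_of_le_left le_sup_right

/-- A tail starting outside a subgraph of `H` misses its subdivision, so only the four pairs of
tails can meet. -/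
lemma IsTailed.disjoint_iff {P P' : (subdivGraph H n).Subgraph} {Q Q' d d' c c' a b a' b'}
    (h : IsTailed P Q d d' a b) (h' : IsTailed P' Q' c c' a' b')
    (hQ : Disjoint Q.verts Q'.verts) :
    Disjoint P.verts P'.verts ↔
      (d = c.symm → a + a' ≤ dartInner n d) ∧ (d' = c'.symm → b + b' ≤ dartInner n d') ∧
      (d = c'.symm → a + b' ≤ dartInner n d) ∧ (d' = c.symm → b + a' ≤ dartInner n d') := by
  rw [h.verts_eq, h'.verts_eq]
  simp only [Set.disjoint_union_left, Set.disjoint_union_right]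
  rw [disjoint_tail_tail (hQ.ne_of_mem h.fst_mem h'.fst_mem) h.le_inner h'.le_inner,
    disjoint_tail_tail (hQ.ne_of_mem h.fst_mem h'.fst_mem') h.le_inner h'.le_inner',
    disjoint_tail_tail (hQ.ne_of_mem h.fst_mem' h'.fst_mem) h.le_inner' h'.le_inner,
    disjoint_tail_tail (hQ.ne_of_mem h.fst_mem' h'.fst_mem') h.le_inner' h'.le_inner']
  have h1 := disjoint_subdiv_subdiv (n := n) hQ
  have h2 := disjoint_tail_subdiv (Set.disjoint_left.1 hQ h.fst_mem) h.le_inner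
  have h3 := disjoint_tail_subdiv (Set.disjoint_left.1 hQ h.fst_mem') h.le_inner'
  have h4 := (disjoint_tail_subdiv (Set.disjoint_right.1 hQ h'.fst_mem) h'.le_inner).symm
  have h5 := (disjoint_tail_subdiv (Set.disjoint_right.1 hQ h'.fst_mem') h'.le_inner').symm
  tauto

lemma IsInner.disjoint_iff {P P' : (subdivGraph H n).Subgraph} {Q c d d' l r a b}
    (h : IsInner P c l r) (h' : IsTailed P' Q d d' a b) (hQ : ¬ Q.Adj c.fst c.snd) :
    Disjoint P.verts P'.verts ↔
      (d = c → a < l) ∧ (d' = c.symm → b + r ≤ dartInner n c) ∧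
      (d = c.symm → a + r ≤ dartInner n c) ∧ (d' = c → b < l) := by
  rw [h'.verts_eq, h.eq]
  simp only [Set.disjoint_union_right]
  rw [disjoint_inner_tail h.one_le h.le h.le_inner h'.le_inner,
    disjoint_inner_tail h.one_le h.le h.le_inner h'.le_inner']
  have h1 := disjoint_inner_subdiv hQ h.one_le h.le_inner
  tauto

end Intersection

/-! ### Mergeability of two classes -/

section Classes

variable {V W : Type*} {H : SimpleGraph W} {n : H.edgeSet → ℕ} {G : SimpleGraph V}
  {P : V → (subdivGraph H n).Subgraph} {a b : V → ℕ} {X Y : Set V}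

/-- The four conditions split into a parallel pair (`d` against `c`, `d'` against `c'`) and a
crossed pair (`d` against `c'`, `d'` against `c`). If both pairs are active, two darts of one class
coincide, so a second tail there is empty by `eq_zero`, and one pair holds automatically. -/
lemma mergeable_tailed_tailed
    (hG : ∀ u v, u ≠ v → (G.Adj u v ↔ ¬ Disjoint (P u).verts (P v).verts))
    (hXY : Disjoint X Y) {Q Q' : H.Subgraph} {d d' c c' : H.Dart}
    (hX : ∀ u ∈ X, IsTailed (P u) Q d d' (a u) (b u))
    (hY : ∀ v ∈ Y, IsTailed (P v) Q' c c' (a v) (b v))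
    (hbX : ∀ u ∈ X, ∀ v ∈ X, a u ≤ a v → b v ≤ b u)
    (hbY : ∀ u ∈ Y, ∀ v ∈ Y, a u ≤ a v → b v ≤ b u) :
    Mergeable G (fun v => (a v : ℤ)) X Y := by
  by_cases hQ : Disjoint Q.verts Q'.verts
  swap
  · obtain ⟨x, hx, hx'⟩ := Set.not_disjoint_iff.1 hQ
    refine Mergeable.of_forall_adj fun u hu v hv => ?_
    rw [hG u v (hXY.ne_of_mem hu hv), Set.not_disjoint_iff]
    exact ⟨Sum.inl x, (hX u hu).subdivSubgraph_le.1 (inl_mem_subdivSubgraph.2 hx),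
      (hY v hv).subdivSubgraph_le.1 (inl_mem_subdivSubgraph.2 hx')⟩
  have hadj : ∀ u ∈ X, ∀ v ∈ Y, (Gᶜ.Adj u v ↔
      (d = c.symm → a u + a v ≤ dartInner n d) ∧ (d' = c'.symm → b u + b v ≤ dartInner n d') ∧
      (d = c'.symm → a u + b v ≤ dartInner n d) ∧
      (d' = c.symm → b u + a v ≤ dartInner n d')) := by
    intro u hu v hv
    have huv := hXY.ne_of_mem hu hv
    rw [compl_adj, hG u v huv, not_not, (hX u hu).disjoint_iff (hY v hv) hQ]
    exact and_iff_right huv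
  have hs : Function.Injective (Dart.symm : H.Dart → H.Dart) := Dart.symm_involutive.injective
  -- The asymmetry is due to `eq_zero`, which empties second tails only: `d = c.symm` makes the
  -- crossed pair trivial, whereas `d' = c'.symm` becomes trivial itself beside an active crossed
  -- condition.
  by_cases hp : d = c.symm ∨ d' = c'.symm ∧ d ≠ c'.symm ∧ d' ≠ c.symm
  · have h34 : ∀ u ∈ X, ∀ v ∈ Y, (d = c'.symm → a u + b v ≤ dartInner n d) ∧
        (d' = c.symm → b u + a v ≤ dartInner n d') := by
      intro u hu v hv
      rcases hp with hp | ⟨-, h1, h2⟩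
      · refine ⟨fun h => ?_, fun h => ?_⟩
        · rw [(hY v hv).eq_zero (hs (hp.symm.trans h))]
          exact (hX u hu).le_inner
        · rw [(hX u hu).eq_zero (hp.trans h.symm), h, dartInner_symm, zero_add]
          exact (hY v hv).le_inner
      · exact ⟨fun h => absurd h h1, fun h => absurd h h2⟩
    -- The parallel conditions bound `a u + a v` and `b u + b v`, so `Y` is reversed; the crossed
    -- ones bound `a u + b v` and `b u + a v` and need no reversal, as `b` decreases with `a`.
    refine ⟨Gᶜ, fun v => (a v : ℤ), -fun v => (a v : ℤ),
      fun u v => d = c.symm → a u + a v ≤ dartInner n d,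
      fun u v => d' = c'.symm → b u + b v ≤ dartInner n d',
      Or.inr rfl, Or.inl rfl, Or.inr rfl, fun u hu v hv => ?_, ?_, ?_⟩
    · rw [hadj u hu v hv]
      exact ⟨fun h => ⟨h.1, h.2.1⟩, fun h => ⟨h.1, h.2, h34 u hu v hv⟩⟩
    · intro u hu u' hu' v hv v' hv' h1 h2 h hd
      dsimp only [Pi.neg_apply] at h1 h2
      have := h hd
      omega
    · intro u hu u' hu' v hv v' hv' h1 h2 h hd
      dsimp only [Pi.neg_apply] at h1 h2
      have := hbX u hu u' hu' (by omega)
      have := hbY v hv v' hv' (by omega)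
      have := h hd
      omega
  · have h12 : ∀ u ∈ X, ∀ v ∈ Y, (d = c.symm → a u + a v ≤ dartInner n d) ∧
        (d' = c'.symm → b u + b v ≤ dartInner n d') := by
      intro u hu v hv
      refine ⟨fun h => absurd (Or.inl h) hp, fun h => ?_⟩
      by_cases h3 : d = c'.symm
      · rw [(hX u hu).eq_zero (h3.trans h.symm), h, dartInner_symm, zero_add]
        exact (hY v hv).le_inner'
      · have h4 : d' = c.symm := by
          by_contra h4
          exact hp (Or.inr ⟨h, h3, h4⟩)
        rw [(hY v hv).eq_zero (hs (h4.symm.trans h))]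
        exact (hX u hu).le_inner'
    refine ⟨Gᶜ, fun v => (a v : ℤ), fun v => (a v : ℤ),
      fun u v => d = c'.symm → a u + b v ≤ dartInner n d,
      fun u v => d' = c.symm → b u + a v ≤ dartInner n d',
      Or.inr rfl, Or.inl rfl, Or.inl rfl, fun u hu v hv => ?_, ?_, ?_⟩
    · rw [hadj u hu v hv]
      exact ⟨fun h => h.2.2, fun h => ⟨(h12 u hu v hv).1, (h12 u hu v hv).2, h⟩⟩
    · intro u hu u' hu' v hv v' hv' h1 h2 h hd
      dsimp only [Pi.neg_apply] at h1 h2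
      have := hbY v hv v' hv' (by omega)
      have := h hd
      omega
    · intro u hu u' hu' v hv v' hv' h1 h2 h hd
      dsimp only [Pi.neg_apply] at h1 h2
      have := hbX u hu u' hu' (by omega)
      have := h hd
      omega

/-- A tail can enter the edge of the inner segments from either end and bounds their left or right
ends accordingly. The conditions pair up by which tail enters from which end, and again one pair is
automatic: a dart has one direction, and an empty tail meets no inner segment. -/
lemma mergeable_inner_tailed
    (hG : ∀ u v, u ≠ v → (G.Adj u v ↔ ¬ Disjoint (P u).verts (P v).verts))
    (hXY : Disjoint X Y) {Q : H.Subgraph} {c d d' : H.Dart}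
    (hX : ∀ u ∈ X, IsInner (P u) c (a u) (b u))
    (hY : ∀ v ∈ Y, IsTailed (P v) Q d d' (a v) (b v))
    (hbX : ∀ u ∈ X, ∀ v ∈ X, a u ≤ a v → b u ≤ b v)
    (hbY : ∀ u ∈ Y, ∀ v ∈ Y, a u ≤ a v → b v ≤ b u) :
    Mergeable G (fun v => (a v : ℤ)) X Y := by
  by_cases hQ : Q.Adj c.fst c.snd
  · refine Mergeable.of_forall_adj fun u hu v hv => ?_
    have hu' := hX u hu
    rw [hG u v (hXY.ne_of_mem hu hv), Set.not_disjoint_iff]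
    refine ⟨dartPoint n c (a u), ?_, (hY v hv).subdivSubgraph_le.1
      ((dartPoint_mem_subdivSubgraph hu'.one_le (hu'.le.trans hu'.le_inner)).2 hQ)⟩
    rw [hu'.eq]
    exact ⟨a u, le_rfl, hu'.le, rfl⟩
  have hadj : ∀ u ∈ X, ∀ v ∈ Y, (Gᶜ.Adj u v ↔
      (d = c → a v < a u) ∧ (d' = c.symm → b v + b u ≤ dartInner n c) ∧
      (d = c.symm → a v + b u ≤ dartInner n c) ∧ (d' = c → b v < a u)) := by
    intro u hu v hv
    have huv := hXY.ne_of_mem hu hv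
    rw [compl_adj, hG u v huv, not_not, (hX u hu).disjoint_iff (hY v hv) hQ]
    exact and_iff_right huv
  have hc : c ≠ c.symm := c.symm_ne.symm
  by_cases hp : d = c ∨ d' = c.symm ∧ d ≠ c.symm
  · have h34 : ∀ u ∈ X, ∀ v ∈ Y, (d = c.symm → a v + b u ≤ dartInner n c) ∧
        (d' = c → b v < a u) := by
      intro u hu v hv
      rcases hp with hp | ⟨hp, h⟩
      · refine ⟨fun h => absurd (hp.symm.trans h) hc, fun h => ?_⟩
        rw [(hY v hv).eq_zero (hp.trans h.symm)]
        exact (hX u hu).one_le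
      · exact ⟨fun h' => absurd h' h, fun h' => absurd (h'.symm.trans hp) hc⟩
    refine Mergeable.symm ⟨Gᶜ, fun v => (a v : ℤ), fun v => (a v : ℤ),
      fun v u => d = c → a v < a u,
      fun v u => d' = c.symm → b v + b u ≤ dartInner n c,
      Or.inr rfl, Or.inl rfl, Or.inl rfl, fun v hv u hu => ?_, ?_, ?_⟩
    · rw [adj_comm, hadj u hu v hv]
      exact ⟨fun h => ⟨h.1, h.2.1⟩, fun h => ⟨h.1, h.2, h34 u hu v hv⟩⟩
    · intro v hv v' hv' u hu u' hu' h1 h2 h hd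
      dsimp only [Pi.neg_apply] at h1 h2
      have := h hd
      omega
    · intro v hv v' hv' u hu u' hu' h1 h2 h hd
      dsimp only [Pi.neg_apply] at h1 h2
      have := hbY v hv v' hv' (by omega)
      have := hbX u' hu' u hu (by omega)
      have := h hd
      omega
  · have h12 : ∀ u ∈ X, ∀ v ∈ Y, (d = c → a v < a u) ∧
        (d' = c.symm → b v + b u ≤ dartInner n c) := by
      intro u hu v hv
      refine ⟨fun h => absurd (Or.inl h) hp, fun h => ?_⟩
      have h3 : d = c.symm := by
        by_contra h3
        exact hp (Or.inr ⟨h, h3⟩)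
      rw [(hY v hv).eq_zero (h3.trans h.symm), zero_add]
      exact (hX u hu).le_inner
    refine Mergeable.symm ⟨Gᶜ, fun v => (a v : ℤ), -fun v => (a v : ℤ),
      fun v u => d = c.symm → a v + b u ≤ dartInner n c,
      fun v u => d' = c → b v < a u,
      Or.inr rfl, Or.inl rfl, Or.inr rfl, fun v hv u hu => ?_, ?_, ?_⟩
    · rw [adj_comm, hadj u hu v hv]
      exact ⟨fun h => h.2.2, fun h => ⟨(h12 u hu v hv).1, (h12 u hu v hv).2, h⟩⟩
    · intro v hv v' hv' u hu u' hu' h1 h2 h hd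
      dsimp only [Pi.neg_apply] at h1 h2
      have := hbX u' hu' u hu (by omega)
      have := h hd
      omega
    · intro v hv v' hv' u hu u' hu' h1 h2 h hd
      dsimp only [Pi.neg_apply] at h1 h2
      have := hbY v hv v' hv' (by omega)
      have := h hd
      omega

end Classes

/-! ### Canonical labels of paths -/

section Normalization

lemma SimpleGraph.Walk.IsPath.ncard_neighborSet_le_one_iff {V : Type*} {G : SimpleGraph V}
    {u v w : V} {p : G.Walk u v} (hp : p.IsPath) (hw : w ∈ p.support) :
    (p.toSubgraph.neighborSet w).ncard ≤ 1 ↔ w = u ∨ w = v := by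
  constructor
  · intro h
    obtain ⟨i, rfl, hi⟩ := Walk.mem_support_iff_exists_getVert.1 hw
    by_cases h0 : i = 0
    · subst h0
      simp
    · by_cases h1 : i < p.length
      · rw [hp.ncard_neighborSet_toSubgraph_internal_eq_two h0 h1] at h
        omega
      · obtain rfl : i = p.length := by omega
        simp
  · intro h
    by_cases hnil : p.Nil
    · have : p.toSubgraph.neighborSet w = ∅ := by
        ext x
        cases p with
        | nil => simp
        | cons h p => exact absurd hnil Walk.not_nil_cons
      simp [this]
    · rcases h with rfl | rfl
      · simp [hp.neighborSet_toSubgraph_startpoint hnil]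
      · simp [hp.neighborSet_toSubgraph_endpoint hnil]

/-- The ends are the vertices with at most one neighbour in the path, so the subgraph alone
determines them up to order. -/
lemma SimpleGraph.Walk.IsPath.ends_eq_of_toSubgraph_eq {V : Type*} {G : SimpleGraph V}
    {u v u' v' : V} {p : G.Walk u v} {p' : G.Walk u' v'} (hp : p.IsPath) (hp' : p'.IsPath)
    (h : p.toSubgraph = p'.toSubgraph) : (u = u' ∧ v = v') ∨ (u = v' ∧ v = u') := by
  have hsupp : ∀ w, w ∈ p.support ↔ w ∈ p'.support := fun w => by
    rw [← Walk.mem_verts_toSubgraph, h, Walk.mem_verts_toSubgraph]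
  have key : ∀ w, (w = u ∨ w = v) ↔ (w = u' ∨ w = v') := by
    intro w
    constructor
    · intro hw
      have hm : w ∈ p.support := by rcases hw with rfl | rfl <;> simp
      have := (hp.ncard_neighborSet_le_one_iff hm).2 hw
      rw [h] at this
      exact (hp'.ncard_neighborSet_le_one_iff ((hsupp w).1 hm)).1 this
    · intro hw
      have hm : w ∈ p'.support := by rcases hw with rfl | rfl <;> simp
      have := (hp'.ncard_neighborSet_le_one_iff hm).2 hw
      rw [← h] at this
      exact (hp.ncard_neighborSet_le_one_iff ((hsupp w).2 hm)).1 this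
  have : ({u, v} : Set V) = {u', v'} := by
    ext w
    simpa using key w
  exact Set.pair_eq_pair_iff.1 this

variable {W : Type*} {H : SimpleGraph W} {n : H.edgeSet → ℕ}

lemma SimpleGraph.Dart.eq_of_edge_eq_of_fst_eq {d d' : H.Dart} (he : d.edge = d'.edge)
    (hf : d.fst = d'.fst) : d = d' := by
  rcases (dart_edge_eq_iff d d').1 he with h | rfl
  · exact h
  · exact absurd hf.symm d'.adj.ne

/-- The two tails can be exchanged so that the second one is trivial when they run along the same
dart. -/
lemma IsTailedFrom.exists_isTailed {P : (subdivGraph H n).Subgraph} {s}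
    (h : IsTailedFrom n P s) : ∃ (x y : W) (q : H.Walk x y) (d d' : H.Dart) (a b : ℕ), q.IsPath ∧
      d.fst = x ∧ d'.fst = y ∧ IsTailed P q.toSubgraph d d' a b := by
  obtain ⟨x, y, q, d, d', a, b, hq, hd, hd', ha, hb, hab, -, hP⟩ := h
  have hx : d.fst ∈ q.toSubgraph.verts := by simp [hd]
  have hy : d'.fst ∈ q.toSubgraph.verts := by simp [hd']
  by_cases hb0 : d = d' ∧ b ≠ 0
  · obtain ⟨rfl, hb0⟩ := hb0
    obtain rfl : a = 0 := (hab rfl).resolve_right hb0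
    refine ⟨x, y, q, d, d, b, 0, hq, hd, hd', hx, hy, hb, Nat.zero_le _, fun _ => rfl, ?_⟩
    rw [hP, sup_assoc, sup_comm, sup_comm (subdivSubgraph n q.toSubgraph)]
  · refine ⟨x, y, q, d, d', a, b, hq, hd, hd', hx, hy, ha, hb, fun h => ?_, hP⟩
    by_contra h0
    exact hb0 ⟨h, h0⟩

lemma IsTailed.symm {P : (subdivGraph H n).Subgraph} {Q d d' a b} (h : IsTailed P Q d d' a b)
    (hne : d ≠ d') : IsTailed P Q d' d b a := by
  refine ⟨h.fst_mem', h.fst_mem, h.le_inner', h.le_inner, fun e => absurd e.symm hne, ?_⟩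
  rw [h.eq, sup_assoc, sup_comm, sup_comm (subdivSubgraph n Q)]

lemma IsTailed.le_of_le {P P' : (subdivGraph H n).Subgraph} {Q d d' a b a' b'}
    (h : IsTailed P Q d d' a b) (h' : IsTailed P' Q d d' a' b') (ha : a ≤ a') (hb : b ≤ b') :
    P ≤ P' := by
  rw [h.eq, h'.eq]
  exact sup_le_sup (sup_le_sup_right (dartSegment_mono _ le_rfl ha) _)
    (dartSegment_mono _ le_rfl hb)

lemma IsInner.le_of_le {P P' : (subdivGraph H n).Subgraph} {c l r l' r'}
    (h : IsInner P c l r) (h' : IsInner P' c l' r') (hl : l' ≤ l) (hr : r ≤ r') : P ≤ P' := by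
  rw [h.eq, h'.eq]
  exact dartSegment_mono _ hl hr

lemma IsInner.symm {P : (subdivGraph H n).Subgraph} {c l r} (h : IsInner P c l r) :
    IsInner P c.symm (dartInner n c + 1 - r) (dartInner n c + 1 - l) := by
  obtain ⟨h1, h2, h3, rfl⟩ := h
  refine ⟨by omega, by omega, ?_, dartSegment_symm c h2 (by omega)⟩
  rw [dartInner_symm]
  omega

/-- A dart along a given edge. -/
noncomputable def edgeDart (e : H.edgeSet) : H.Dart := (exists_dart_subdivPoint 0 e).choose

lemma edgeDart_edge (e : H.edgeSet) : (edgeDart e).edge = e.1 :=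
  (exists_dart_subdivPoint 0 e).choose_spec.1

/-- The path in `H` consisting of a single edge. -/
noncomputable def edgePath (e : H.edgeSet) : {Q : H.Subgraph // IsPathSubgraph Q} :=
  ⟨(edgeDart e).adj.toWalk.toSubgraph, _, _, (edgeDart e).adj.toWalk, by
    simp [Walk.isPath_def, (edgeDart e).adj.ne], rfl⟩

lemma edgePath_adj (e : H.edgeSet) :
    (edgePath e).1.Adj (edgeDart e).fst (edgeDart e).snd := by
  simp [edgePath]

/-- The first end of a path in `H`, directed arbitrarily. -/
noncomputable def pathStart (Q : {Q : H.Subgraph // IsPathSubgraph Q}) : W := Q.2.choose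

/-- The last end of a path in `H`, directed arbitrarily. -/
noncomputable def pathEnd (Q : {Q : H.Subgraph // IsPathSubgraph Q}) : W :=
  Q.2.choose_spec.choose

lemma pathStart_pathEnd (Q : {Q : H.Subgraph // IsPathSubgraph Q}) :
    ∃ p : H.Walk (pathStart Q) (pathEnd Q), p.IsPath ∧ Q.1 = p.toSubgraph :=
  Q.2.choose_spec.choose_spec

/-- The path `P` of the subdivision is inner to the first edge of the label, or consists of the
path in the label with tails along the two edges of the label. -/
def HasLabel (c : H.edgeSet × H.edgeSet × {Q : H.Subgraph // IsPathSubgraph Q})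
    (P : (subdivGraph H n).Subgraph) (a b : ℕ) : Prop :=
  (c = (c.1, c.1, edgePath c.1) ∧ IsInner P (edgeDart c.1) a b) ∨
    ∃ d d' : H.Dart, d.edge = c.1 ∧ d'.edge = c.2.1 ∧ d.fst = pathStart c.2.2 ∧
      d'.fst = pathEnd c.2.2 ∧ IsTailed P c.2.2.1 d d' a b

lemma IsPathSubgraph.exists_hasLabel (hdart : ∀ x : W, ∃ d : H.Dart, d.fst = x)
    {P : (subdivGraph H n).Subgraph} (hP : IsPathSubgraph P) : ∃ c a b, HasLabel c P a b := by
  obtain ⟨s, t, p, hp, rfl⟩ := hP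
  rcases hp.inner_or_tailed hdart with h | h
  · obtain ⟨c, l, r, h1, h2, h3, -, h4⟩ := h
    have hc : IsInner p.toSubgraph c l r := ⟨h1, h2, h3, h4⟩
    let e : H.edgeSet := ⟨c.edge, c.edge_mem⟩
    refine ⟨(e, e, edgePath e), ?_⟩
    rcases (dart_edge_eq_iff _ _).1 (edgeDart_edge e) with he | he
    · exact ⟨l, r, Or.inl ⟨rfl, he ▸ hc⟩⟩
    · exact ⟨_, _, Or.inl ⟨rfl, he ▸ hc.symm⟩⟩
  · obtain ⟨x, y, q, d, d', a, b, hq, hd, hd', h⟩ := h.exists_isTailed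
    let Q : {Q : H.Subgraph // IsPathSubgraph Q} := ⟨q.toSubgraph, x, y, q, hq, rfl⟩
    obtain ⟨q', hq', hQ⟩ := pathStart_pathEnd Q
    have key : ∃ d d' a b, d.fst = pathStart Q ∧ d'.fst = pathEnd Q ∧
        IsTailed p.toSubgraph Q.1 d d' a b := by
      rcases hq.ends_eq_of_toSubgraph_eq hq' hQ with ⟨h1, h2⟩ | ⟨h1, h2⟩
      · exact ⟨d, d', a, b, hd.trans h1, hd'.trans h2, h⟩
      -- If the darts coincide, so do both ends of `q`. The tails then need no exchange, which would
      -- spoil the convention `b = 0`.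
      · by_cases hdd : d = d'
        · subst hdd
          exact ⟨d, d, a, b, hd'.trans h2, hd.trans h1, h⟩
        · exact ⟨d', d, b, a, hd'.trans h2, hd.trans h1, h.symm hdd⟩
    obtain ⟨d, d', a, b, hd, hd', h⟩ := key
    exact ⟨(⟨d.edge, d.edge_mem⟩, ⟨d'.edge, d'.edge_mem⟩, Q), a, b,
      Or.inr ⟨d, d', rfl, rfl, hd, hd', h⟩⟩

end Normalization

/-! ### Structure of the classes and conclusion -/

section Main

variable {V W : Type*} {H : SimpleGraph W} {n : H.edgeSet → ℕ} {G : SimpleGraph V}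
  {P : V → (subdivGraph H n).Subgraph} {a b : V → ℕ}
  {X : Set V}

/-- Inner paths reuse labels of tailed ones, which keeps the number of parts at m²k. Properness
makes this harmless: a tailed path with such a label covers the whole edge and would contain the
inner path. -/
lemma forall_isInner_or_forall_isTailed (hP : ∀ u v, u ≠ v → ¬ P u ≤ P v)
    {c : H.edgeSet × H.edgeSet × {Q : H.Subgraph // IsPathSubgraph Q}}
    (hX : ∀ v ∈ X, HasLabel c (P v) (a v) (b v)) :
    (∀ v ∈ X, c = (c.1, c.1, edgePath c.1) ∧ IsInner (P v) (edgeDart c.1) (a v) (b v)) ∨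
      ∃ d d', ∀ v ∈ X, IsTailed (P v) c.2.2.1 d d' (a v) (b v) := by
  by_cases hin : ∀ v ∈ X, c = (c.1, c.1, edgePath c.1) ∧
      IsInner (P v) (edgeDart c.1) (a v) (b v)
  · exact Or.inl hin
  push Not at hin
  obtain ⟨w, hw, hwc⟩ := hin
  have hwX := hX w hw
  obtain ⟨d, d', hd, hd', hs, he, hwt⟩ := hwX.resolve_left fun h => hwc h.1 h.2
  refine Or.inr ⟨d, d', fun v hv => ?_⟩
  rcases hX v hv with ⟨hc, hi⟩ | ⟨e, e', h1, h2, h3, h4, ht⟩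
  · by_cases hvw : v = w
    · exact hvw ▸ hwt
    · refine absurd (le_trans ?_ hwt.subdivSubgraph_le) (hP v w hvw)
      rw [hi.eq, hc]
      have := hi.le_inner
      exact dartSegment_le_subdivSubgraph (edgePath_adj c.1) (by omega)
  -- The label fixes the edge and the start of each tail, hence its dart, so the whole class shares
  -- `d` and `d'`.
  · rwa [← Dart.eq_of_edge_eq_of_fst_eq (h1.trans hd.symm) (h3.trans hs.symm),
      ← Dart.eq_of_edge_eq_of_fst_eq (h2.trans hd'.symm) (h4.trans he.symm)]

lemma isInner_monotone (hP : ∀ u v, u ≠ v → ¬ P u ≤ P v) {c : H.Dart}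
    (hX : ∀ v ∈ X, IsInner (P v) c (a v) (b v)) :
    ∀ u ∈ X, ∀ v ∈ X, a u ≤ a v → b u ≤ b v := by
  intro u hu v hv h
  by_contra hlt
  by_cases huv : v = u
  · subst huv
    exact hlt le_rfl
  · exact hP v u huv ((hX v hv).le_of_le (hX u hu) h (by omega))

lemma isTailed_antitone (hP : ∀ u v, u ≠ v → ¬ P u ≤ P v) {Q : H.Subgraph} {d d' : H.Dart}
    (hX : ∀ v ∈ X, IsTailed (P v) Q d d' (a v) (b v)) :
    ∀ u ∈ X, ∀ v ∈ X, a u ≤ a v → b v ≤ b u := by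
  intro u hu v hv h
  by_contra hlt
  by_cases huv : u = v
  · subst huv
    exact hlt le_rfl
  · exact hP u v huv ((hX u hu).le_of_le (hX v hv) h (by omega))

lemma isInner_injOn (hP : ∀ u v, u ≠ v → ¬ P u ≤ P v) {c : H.Dart}
    (hX : ∀ v ∈ X, IsInner (P v) c (a v) (b v)) : Set.InjOn (fun v => (a v : ℤ)) X := by
  intro u hu v hv h
  have h : a u = a v := by simpa using h
  by_contra huv
  exact hP u v huv ((hX u hu).le_of_le (hX v hv) h.ge (isInner_monotone hP hX u hu v hv h.le))

lemma isTailed_injOn (hP : ∀ u v, u ≠ v → ¬ P u ≤ P v) {Q : H.Subgraph} {d d' : H.Dart}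
    (hX : ∀ v ∈ X, IsTailed (P v) Q d d' (a v) (b v)) : Set.InjOn (fun v => (a v : ℤ)) X := by
  intro u hu v hv h
  have h : a u = a v := by simpa using h
  by_contra huv
  exact hP u v huv
    ((hX u hu).le_of_le (hX v hv) h.le (isTailed_antitone hP hX v hv u hu h.ge))

/-- The members are intervals on a line, and properness makes left and right ends increase together.
-/
lemma isInner_goodOrder
    (hG : ∀ u v, u ≠ v → (G.Adj u v ↔ ¬ Disjoint (P u).verts (P v).verts))
    (hP : ∀ u v, u ≠ v → ¬ P u ≤ P v) {c : H.Dart}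
    (hX : ∀ v ∈ X, IsInner (P v) c (a v) (b v)) :
    GoodOrder X X (fun u v => (a u : ℤ) ≤ a v) G := by
  have hmono := isInner_monotone hP hX
  have hadj : ∀ u ∈ X, ∀ v ∈ X, u ≠ v → (G.Adj u v ↔ ¬ (b u < a v ∨ b v < a u)) := by
    intro u hu v hv huv
    rw [hG u v huv, (hX u hu).eq, (hX v hv).eq,
      disjoint_inner_inner (hX u hu).le (hX u hu).le_inner (hX v hv).le (hX v hv).le_inner]
  refine ⟨fun u v w h => ?_, fun u v w h => ?_⟩
  · rw [or_self_iff] at h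
    obtain ⟨hu, hv, hw⟩ := h
    rintro ⟨h1, -⟩ ⟨h2, hvw⟩ h
    rw [hadj u hu w hw h.ne] at h
    rw [hadj v hv w hw hvw]
    have := hmono u hu v hv (by omega)
    have := (hX w hw).le
    omega
  · rw [or_self_iff] at h
    obtain ⟨hv, hw, hu⟩ := h
    rintro ⟨h1, huv⟩ ⟨h2, -⟩ h
    rw [hadj u hu w hw h.ne] at h
    rw [hadj u hu v hv huv]
    have := (hX v hv).le
    omega

/-- All members contain the subdivision of `Q`, so the class is a clique and any order works. -/
lemma isTailed_goodOrder
    (hG : ∀ u v, u ≠ v → (G.Adj u v ↔ ¬ Disjoint (P u).verts (P v).verts))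
    {Q : H.Subgraph} {d d' : H.Dart}
    (hX : ∀ v ∈ X, IsTailed (P v) Q d d' (a v) (b v)) (r : V → V → Prop) :
    GoodOrder X X r G := by
  have hadj : ∀ u ∈ X, ∀ v ∈ X, u ≠ v → G.Adj u v := by
    intro u hu v hv huv
    have hm := inl_mem_subdivSubgraph (n := n).2 (hX u hu).fst_mem
    rw [hG u v huv, Set.not_disjoint_iff]
    exact ⟨_, (hX u hu).subdivSubgraph_le.1 hm, (hX v hv).subdivSubgraph_le.1 hm⟩
  refine ⟨fun u v w h => ?_, fun u v w h => ?_⟩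
  · rw [or_self_iff] at h
    exact fun _ h2 _ => hadj v h.2.1 w h.2.2 h2.2
  · rw [or_self_iff] at h
    exact fun h1 _ _ => hadj u h.2.2 v h.1 h1.2

/-- Proper intersection graphs of paths in `subdivGraph H n` are proper mixed-thin. -/
lemma isProperMixedThin_of_subdivGraph [Finite W] (hconn : H.Connected)
    (hm : 1 ≤ H.edgeSet.ncard) (hG : IsProperPathIntersectionGraph G (subdivGraph H n)) :
    IsProperMixedThin G (H.edgeSet.ncard ^ 2 * numPaths H) := by
  obtain ⟨P, hpath, hadj, hP⟩ := hG
  replace hadj : ∀ u v, u ≠ v → (G.Adj u v ↔ ¬ Disjoint (P u).verts (P v).verts) :=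
    fun u v h => by rw [hadj u v h, Set.not_disjoint_iff_nonempty_inter]
  -- Even an empty tail needs a dart for its label; connectedness and the existence of an edge rule
  -- out isolated vertices.
  have hdart : ∀ x : W, ∃ d : H.Dart, d.fst = x := by
    obtain ⟨e, he⟩ : H.edgeSet.Nonempty := Set.nonempty_of_ncard_ne_zero (by omega)
    have : Nontrivial W := ⟨_, _, (edgeDart ⟨e, he⟩).adj.ne⟩
    intro x
    obtain ⟨y, hy⟩ := hconn.preconnected.exists_adj_of_nontrivial x
    exact ⟨⟨(x, y), hy⟩, rfl⟩
  have hcard : Nat.card (H.edgeSet × H.edgeSet × {Q : H.Subgraph // IsPathSubgraph Q}) =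
      H.edgeSet.ncard ^ 2 * numPaths H := by
    rw [Nat.card_prod, Nat.card_prod, sq, mul_assoc]
    rfl
  have hpos : 0 < H.edgeSet.ncard ^ 2 * numPaths H := by
    rw [← hcard]
    obtain ⟨e, he⟩ : H.edgeSet.Nonempty := Set.nonempty_of_ncard_ne_zero (by omega)
    have : Nonempty (H.edgeSet × H.edgeSet × {Q : H.Subgraph // IsPathSubgraph Q}) :=
      ⟨⟨e, he⟩, ⟨e, he⟩, edgePath ⟨e, he⟩⟩
    exact Nat.card_pos
  choose lab a b hlab using fun v => (hpath v).exists_hasLabel hdart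
  have hclass := fun c => forall_isInner_or_forall_isTailed (X := {v | lab v = c}) (c := c) hP
    (fun v (hv : lab v = c) => hv ▸ hlab v)
  refine isProperMixedThin_of_mergeable (key := fun v => (a v : ℤ))
    (Finite.equivFinOfCardEq hcard) hpos lab (fun c => ?_) (fun c => ?_) (fun c c' hcc => ?_)
  · rcases hclass c with h | ⟨d, d', h⟩
    · exact isInner_injOn hP fun v hv => (h v hv).2
    · exact isTailed_injOn hP h
  · rcases hclass c with h | ⟨d, d', h⟩
    · exact ⟨G, Or.inl rfl, isInner_goodOrder hadj hP fun v hv => (h v hv).2⟩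
    · exact ⟨G, Or.inl rfl, isTailed_goodOrder hadj h _⟩
  · have hdisj : Disjoint {v | lab v = c} {v | lab v = c'} :=
      Set.disjoint_left.2 fun v h h' => hcc (Eq.trans (Eq.symm h) h')
    rcases hclass c with h | ⟨d, d', h⟩ <;> rcases hclass c' with h' | ⟨e, e', h'⟩
    -- The label of an inner class is determined by its edge, so distinct inner classes lie on
    -- distinct edges.
    · refine Mergeable.of_forall_not_adj hdisj fun u hu v hv => ?_
      have hu' := h u hu
      have hv' := h' v hv
      rw [hadj u v (hdisj.ne_of_mem hu hv), not_not, hu'.2.eq, hv'.2.eq]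
      refine disjoint_inner_inner_of_edge_ne (fun he => hcc ?_) hu'.2.one_le hu'.2.le_inner
        hv'.2.le_inner
      rw [edgeDart_edge, edgeDart_edge] at he
      rw [hu'.1, hv'.1, Subtype.ext he]
    · exact mergeable_inner_tailed hadj hdisj (fun v hv => (h v hv).2) h'
        (isInner_monotone hP fun v hv => (h v hv).2) (isTailed_antitone hP h')
    · exact (mergeable_inner_tailed hadj hdisj.symm (fun v hv => (h' v hv).2) h
        (isInner_monotone hP fun v hv => (h' v hv).2) (isTailed_antitone hP h)).symm
    · exact mergeable_tailed_tailed hadj hdisj h h' (isTailed_antitone hP h)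
        (isTailed_antitone hP h')

lemma IsProperPathIntersectionGraph.of_iso {W₁ W₂ : Type*} {H₁ : SimpleGraph W₁}
    {H₂ : SimpleGraph W₂} (f : H₁ ≃g H₂) (h : IsProperPathIntersectionGraph G H₁) :
    IsProperPathIntersectionGraph G H₂ := by
  obtain ⟨P, hpath, hadj, hP⟩ := h
  refine ⟨fun v => (P v).map f.toHom, fun v => ?_, fun u v huv => ?_, fun u v huv h => ?_⟩
  · obtain ⟨x, y, p, hp, h⟩ := hpath v
    refine ⟨_, _, p.map f.toHom, hp.map f.injective, ?_⟩
    exact (congrArg _ h).trans (Walk.toSubgraph_map f.toHom p).symm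
  · rw [hadj u v huv, Subgraph.map_verts, Subgraph.map_verts,
      ← Set.image_inter (f := f.toHom) f.injective, Set.image_nonempty]
  · refine hP u v huv ?_
    have h2 := Subgraph.map_mono (f := f.symm.toHom) h
    have hid : f.symm.toHom.comp f.toHom = Hom.id := by
      ext x
      exact f.symm_apply_apply x
    rwa [← Subgraph.map_comp, ← Subgraph.map_comp, hid, Subgraph.map_id, Subgraph.map_id] at h2

end Main

theorem theorem2 {V W W' : Type*} [Finite V] [Finite W]
    (G : SimpleGraph V) (H : SimpleGraph W) (H' : SimpleGraph W')
    (hconn : H.Connected) (hm : 1 ≤ H.edgeSet.ncard)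
    (hsub : IsSubdivision H H')
    (hG : IsProperPathIntersectionGraph G H') :
    IsProperMixedThin G (H.edgeSet.ncard ^ 2 * numPaths H) := by
  obtain ⟨n, ⟨f⟩⟩ := hsub
  exact isProperMixedThin_of_subdivGraph hconn hm (hG.of_iso f)
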